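/- Let $n\ge 1$ and $[n]=\{1,\dots,n\}$, and let $[n]'=\{1',\dots,n'\}$ be a disjoint copy of $[n]$. The partition monoid $\mathcal P_n$ is the set of all equivalence relations on $[n]\cup[n]'$. The product $\alpha\beta$ is formed as follows: place $\alpha$ on top of $\beta$, identifying the lower row $1',\dots,n'$ of $\alpha$ with the upper row $1,\dots,n$ of $\beta$; take the equivalence relation generated by $\alpha$ and $\beta$ on the resulting three rows; and restrict it to the two outer rows. The equivalence classes of $\alpha\in\mathcal P_n$ are called its blocks. The rank of $\alpha$ is the number of its blocks that meet both $[n]$ and $[n]'$. Further, $\operatorname{dom}(\alpha)$ is the set of $i\in[n]$ whose block meets $[n]'$; $\operatorname{codom}(\alpha)$ is the set of $i\in[n]$ such that the block of $i'$ meets $[n]$; $\ker(\alpha)$ is the set of pairs $(i,j)\in[n]\times[n]$ such that $i$ and $j$ lie in the same block; and $\operatorname{coker}(\alpha)$ is the set of pairs $(i,j)\in[n]\times[n]$ such that $i'$ and $j'$ lie in the same block. For a finite semigroup $S$, a subset $A\subseteq S$ generates $S$ if every element of $S$ is a product of one or more elements of $A$; $\operatorname{rank}(S)$ is the least cardinality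 of a generating set of $S$; $S$ is idempotent generated if its idempotents generate it; and in that case $\operatorname{idrank}(S)$ is the least cardinality of a generating set of $S$ consisting of idempotents. Theorem. Let $0\le r\le n-1$ and let $I_r(\mathcal P_n)=\{\alpha\in\mathcal P_n:\operatorname{rank}(\alpha)\le r\}$, a two-sided ideal of $\mathcal P_n$. The semigroup $I_r(\mathcal P_n)$ is idempotent generated, and \[ \operatorname{rank}(I_r(\mathcal P_n))=\operatorname{idrank}(I_r(\mathcal P_n))=\sum_{j=r}^n S(n,j)\binom{j}{r}=\sum_{j=r}^n\binom{n}{j}S(j,r)B_{n-j}, \] where $S(j,k)$ denotes the Stirling number of the second kind and $B_k$ the $k$th Bell number. Moreover, a subset $A\subseteq I_r(\mathcal P_n)$ of this cardinality is a generating set for $I_r(\mathcal P_n)$ if and only if the following three conditions hold: (1) $\operatorname{rank}(\alpha)=r$ for all $\alpha\in A$; (2) for all $\alpha,\beta\in A$ with $\alpha\ne\beta$, either $\ker(\alpha)\ne\ker(\beta)$ or $\operatorname{dom}(\alpha)\ne\operatorname{dom}(\beta)$; (3) for all $\alpha,\beta\in A$ with $\alpha\ne\beta$, either $\operatorname{coker}(\alpha)\ne\operatorname{coker}(\beta)$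 or $\operatorname{codom}(\alpha)\ne\operatorname{codom}(\beta)$. -/

import Mathlib

/-- A partition of degree `n`: an equivalence relation on the disjoint union `[n] ∪ [n]'`. The
point `i` of the upper row `[n]` is `Sum.inl i`, the point `i'` of the lower row `[n]'` is
`Sum.inr i`. -/
@[ext]
structure PartitionMonoid (n : ℕ) where
  /-- the underlying equivalence relation -/
  eqv : Setoid (Fin n ⊕ Fin n)

namespace PartitionMonoid

/-! ### Auxiliary facts on equivalence relations -/

theorem setoid_map_le {α β : Type*} {f : α → β} {r : Setoid α} {s : Setoid β} :
    r.map f ≤ s ↔ r ≤ Setoid.comap f s := by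
  constructor
  · intro h
    exact le_trans Setoid.le_comap_map fun x y hxy => h hxy
  · intro h
    refine Setoid.eqvGen_le ?_
    rintro _ _ ⟨a, b, hab, rfl, rfl⟩
    exact h hab

theorem setoid_map_rel {α β : Type*} (f : α → β) (r : Setoid α) {a b : α} (h : r a b) :
    r.map f (f a) (f b) :=
  (setoid_map_le.1 (le_refl (r.map f))) h

theorem setoid_map_map {α β γ : Type*} (f : α → β) (g : β → γ) (r : Setoid α) :
    (r.map f).map g = r.map (g ∘ f) := by
  refine eq_of_forall_ge_iff fun s => ?_
  rw [setoid_map_le, setoid_map_le, setoid_map_le]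
  rfl

theorem setoid_map_sup {α β : Type*} (f : α → β) (r s : Setoid α) :
    (r ⊔ s).map f = r.map f ⊔ s.map f := by
  refine eq_of_forall_ge_iff fun t => ?_
  rw [setoid_map_le, sup_le_iff, sup_le_iff, setoid_map_le, setoid_map_le]

theorem setoid_comap_sup_map {V W : Type*} (f : W → V) (r : Setoid V) (s : Setoid W) :
    Setoid.comap f (r ⊔ s.map f) = Setoid.comap f r ⊔ s := by
  apply le_antisymm
  · let N : V → Set W := fun v => {a | ∃ c, r (f c) v ∧ (Setoid.comap f r ⊔ s) a c}
    have hN : ∀ w, N (f w) = {a | (Setoid.comap f r ⊔ s) a w} := by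
      intro w
      ext a
      constructor
      · rintro ⟨c, h1, h2⟩
        exact (Setoid.comap f r ⊔ s).trans' h2
          ((le_sup_left : Setoid.comap f r ≤ Setoid.comap f r ⊔ s) h1)
      · intro h
        exact ⟨w, r.refl' _, h⟩
    have key : r ⊔ s.map f ≤ Setoid.ker N := by
      refine sup_le ?_ (setoid_map_le.2 ?_)
      · intro x y hxy
        change N x = N y
        ext a
        constructor
        · rintro ⟨c, h1, h2⟩
          exact ⟨c, r.trans' h1 hxy, h2⟩
        · rintro ⟨c, h1, h2⟩
          exact ⟨c, r.trans' h1 (r.symm' hxy), h2⟩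
      · intro x y hxy
        have h' := (le_sup_right : s ≤ Setoid.comap f r ⊔ s) hxy
        change N (f x) = N (f y)
        rw [hN, hN]
        ext a
        exact ⟨fun h => Setoid.trans' _ h h', fun h => Setoid.trans' _ h (Setoid.symm' _ h')⟩
    intro x y hxy
    have h : N (f x) = N (f y) := key hxy
    rw [hN, hN] at h
    have : x ∈ {a | (Setoid.comap f r ⊔ s) a x} := (Setoid.comap f r ⊔ s).refl' x
    rw [h] at this
    exact this
  · refine sup_le ?_ ?_
    · intro x y h
      exact (le_sup_left : r ≤ r ⊔ s.map f) h
    · rw [← setoid_map_le]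
      exact le_sup_right

theorem setoid_comap_map {A V W X : Type*} {e : W → V} {j : X → V} {o : A → X} {u : A → W}
    (he : Function.Injective e) (hj : Function.Injective j) (hc : ∀ a, e (u a) = j (o a))
    (hp : ∀ w x, e w = j x → ∃ a, u a = w ∧ o a = x) (t : Setoid X) :
    Setoid.comap e (t.map j) = (Setoid.comap o t).map u := by
  apply le_antisymm
  · intro w w' h
    have h' : (t.map j) (e w) (e w') := h
    rw [Setoid.coe_map_of_ker_le _ _ (Setoid.ker_eq_bot_iff.2 hj ▸ bot_le)] at h'
    rcases h' with ⟨x, y, hxy, hx, hy⟩ | h'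
    · obtain ⟨a, rfl, rfl⟩ := hp w x hx.symm
      obtain ⟨b, rfl, rfl⟩ := hp w' y hy.symm
      exact setoid_map_rel u _ hxy
    · rw [he h']
  · rw [setoid_map_le]
    intro a b h
    change t.map j (e (u a)) (e (u b))
    rw [hc, hc]
    exact setoid_map_rel j t h

/-! ### The product -/

variable {n : ℕ}

/-- Inclusion of the two rows of the first factor as the upper and middle rows of the stacked
three-row diagram. -/
def upperRows : Fin n ⊕ Fin n → Fin n ⊕ (Fin n ⊕ Fin n)
  | .inl i => .inl i
  | .inr i => .inr (.inl i)

/-- Inclusion of the two rows of the second factor as the middle and lower rows of the stacked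
three-row diagram. -/
def lowerRows : Fin n ⊕ Fin n → Fin n ⊕ (Fin n ⊕ Fin n)
  | .inl i => .inr (.inl i)
  | .inr i => .inr (.inr i)

/-- Inclusion of the two outer rows (upper and lower) in the stacked three-row diagram. -/
def outerRows : Fin n ⊕ Fin n → Fin n ⊕ (Fin n ⊕ Fin n)
  | .inl i => .inl i
  | .inr i => .inr (.inr i)

/-- The connected components of the diagram obtained by stacking `α` on top of `β`: the
equivalence relation on the three rows generated by `α` (on the upper and middle rows) and `β`
(on the middle and lower rows). -/
def stack (α β : PartitionMonoid n) : Setoid (Fin n ⊕ (Fin n ⊕ Fin n)) :=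
  α.eqv.map upperRows ⊔ β.eqv.map lowerRows

/-- The product of `α` and `β`: stack `α` on top of `β`, form connected components, and delete
the middle row. -/
instance : Mul (PartitionMonoid n) where
  mul α β := ⟨Setoid.comap outerRows (stack α β)⟩

/-- The identity partition, whose blocks are the sets `{i, i'}`. -/
instance : One (PartitionMonoid n) where
  one := ⟨Setoid.ker (Sum.elim id id)⟩

theorem mul_eqv (α β : PartitionMonoid n) :
    (α * β).eqv = Setoid.comap outerRows (stack α β) := rfl

theorem one_eqv : (1 : PartitionMonoid n).eqv = Setoid.ker (Sum.elim id id) := rfl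

/-- The reflection of `α` in a horizontal axis. -/
def star (α : PartitionMonoid n) : PartitionMonoid n :=
  ⟨Setoid.comap Sum.swap α.eqv⟩

theorem one_mul_aux (β : PartitionMonoid n) : 1 * β = β := by
  apply PartitionMonoid.ext
  rw [mul_eqv]
  let c : Fin n ⊕ (Fin n ⊕ Fin n) → Fin n ⊕ Fin n := Sum.elim Sum.inl id
  apply le_antisymm
  · have h : stack 1 β ≤ Setoid.comap c β.eqv := by
      refine sup_le (setoid_map_le.2 ?_) (setoid_map_le.2 ?_)
      · intro x y hxy
        rcases x with i | i <;> rcases y with k | k <;> cases (show i = k from hxy) <;>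
          exact β.eqv.refl' _
      · intro x y hxy
        rcases x with i | i <;> rcases y with k | k <;> exact hxy
    intro x y hxy
    have := h hxy
    rcases x with i | i <;> rcases y with k | k <;> exact this
  · intro x y hxy
    have h1 : ∀ x, stack 1 β (outerRows x) (lowerRows x) := by
      rintro (i | i)
      · exact (le_sup_left : _ ≤ stack 1 β)
          (setoid_map_rel upperRows (1 : PartitionMonoid n).eqv
            (a := .inl i) (b := .inr i) rfl)
      · exact (stack 1 β).refl' _
    exact (stack 1 β).trans' (h1 x) ((stack 1 β).trans'
      ((le_sup_right : _ ≤ stack 1 β) (setoid_map_rel lowerRows β.eqv hxy))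
      ((stack 1 β).symm' (h1 y)))

theorem mul_one_aux (β : PartitionMonoid n) : β * 1 = β := by
  apply PartitionMonoid.ext
  rw [mul_eqv]
  let c : Fin n ⊕ (Fin n ⊕ Fin n) → Fin n ⊕ Fin n := Sum.elim Sum.inl (Sum.elim Sum.inr Sum.inr)
  apply le_antisymm
  · have h : stack β 1 ≤ Setoid.comap c β.eqv := by
      refine sup_le (setoid_map_le.2 ?_) (setoid_map_le.2 ?_)
      · intro x y hxy
        rcases x with i | i <;> rcases y with k | k <;> exact hxy
      · intro x y hxy
        rcases x with i | i <;> rcases y with k | k <;> cases (show i = k from hxy) <;>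
          exact β.eqv.refl' _
    intro x y hxy
    have := h hxy
    rcases x with i | i <;> rcases y with k | k <;> exact this
  · intro x y hxy
    have h1 : ∀ x, stack β 1 (outerRows x) (upperRows x) := by
      rintro (i | i)
      · exact (stack β 1).refl' _
      · exact (le_sup_right : _ ≤ stack β 1)
          (setoid_map_rel lowerRows (1 : PartitionMonoid n).eqv
            (a := .inr i) (b := .inl i) rfl)
    exact (stack β 1).trans' (h1 x) ((stack β 1).trans'
      ((le_sup_left : _ ≤ stack β 1) (setoid_map_rel upperRows β.eqv hxy))
      ((stack β 1).symm' (h1 y)))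

theorem mul_assoc_aux (α β γ : PartitionMonoid n) : α * β * γ = α * (β * γ) := by
  apply PartitionMonoid.ext
  -- the four-row diagram has vertex set `Fin n ⊕ (Fin n ⊕ (Fin n ⊕ Fin n))`
  let j₁ : Fin n ⊕ (Fin n ⊕ Fin n) → Fin n ⊕ (Fin n ⊕ (Fin n ⊕ Fin n)) :=
    Sum.elim Sum.inl (Sum.elim (Sum.inr ∘ Sum.inl) (Sum.inr ∘ Sum.inr ∘ Sum.inl))
  let j₂ : Fin n ⊕ (Fin n ⊕ Fin n) → Fin n ⊕ (Fin n ⊕ (Fin n ⊕ Fin n)) := Sum.inr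
  let e₁ : Fin n ⊕ (Fin n ⊕ Fin n) → Fin n ⊕ (Fin n ⊕ (Fin n ⊕ Fin n)) :=
    Sum.elim Sum.inl (Sum.inr ∘ Sum.inr)
  let e₂ : Fin n ⊕ (Fin n ⊕ Fin n) → Fin n ⊕ (Fin n ⊕ (Fin n ⊕ Fin n)) :=
    Sum.elim Sum.inl (Sum.elim (Sum.inr ∘ Sum.inl) (Sum.inr ∘ Sum.inr ∘ Sum.inr))
  let G : Setoid (Fin n ⊕ (Fin n ⊕ (Fin n ⊕ Fin n))) :=
    α.eqv.map (j₁ ∘ upperRows) ⊔ β.eqv.map (j₁ ∘ lowerRows) ⊔ γ.eqv.map (e₁ ∘ lowerRows)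
  have inj : ∀ {f : Fin n ⊕ (Fin n ⊕ Fin n) → Fin n ⊕ (Fin n ⊕ (Fin n ⊕ Fin n))},
      (f = j₁ ∨ f = j₂ ∨ f = e₁ ∨ f = e₂) → Function.Injective f := by
    intro f hf x y hxy
    rcases hf with rfl | rfl | rfl | rfl <;> rcases x with x | x | x <;>
      rcases y with y | y | y <;> simp_all [j₁, j₂, e₁, e₂]
  have hL : stack (α * β) γ = Setoid.comap e₁ G := by
    have h2 : G = (stack α β).map j₁ ⊔ (γ.eqv.map lowerRows).map e₁ := by
      simp only [G, stack, setoid_map_sup, setoid_map_map]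
    rw [h2, setoid_comap_sup_map, stack, mul_eqv]
    congr 1
    refine (setoid_comap_map (inj (by simp)) (inj (by simp)) ?_ ?_ _).symm
    · rintro (i | i) <;> rfl
    · rintro (w | w | w) (x | x | x) h <;>
        simp [e₁, j₁] at h <;> subst h
      · exact ⟨.inl w, rfl, rfl⟩
      · exact ⟨.inr w, rfl, rfl⟩
  have hR : stack α (β * γ) = Setoid.comap e₂ G := by
    have h2 : G = (stack β γ).map j₂ ⊔ (α.eqv.map upperRows).map e₂ := by
      simp only [G, stack, setoid_map_sup, setoid_map_map]
      have a1 : j₁ ∘ upperRows = e₂ ∘ upperRows := by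
        funext x; rcases x with x | x <;> rfl
      have a2 : j₁ ∘ lowerRows = j₂ ∘ upperRows := by
        funext x; rcases x with x | x <;> rfl
      have a3 : e₁ ∘ lowerRows = j₂ ∘ lowerRows := by
        funext x; rcases x with x | x <;> rfl
      rw [a1, a2, a3, sup_assoc, sup_comm]
    rw [h2, setoid_comap_sup_map, stack, mul_eqv, sup_comm]
    congr 1
    refine (setoid_comap_map (inj (by simp)) (inj (by simp)) ?_ ?_ _).symm
    · rintro (i | i) <;> rfl
    · rintro (w | w | w) (x | x | x) h <;>
        simp [e₂, j₂] at h <;> subst h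
      · exact ⟨.inl w, rfl, rfl⟩
      · exact ⟨.inr w, rfl, rfl⟩
  rw [mul_eqv, mul_eqv, hL, hR, ← Setoid.comap_comp, ← Setoid.comap_comp]
  congr 1
  funext x
  rcases x with x | x <;> rfl

/-- The partition monoid `𝒫ₙ`. -/
instance : Monoid (PartitionMonoid n) where
  mul_assoc := mul_assoc_aux
  one_mul := one_mul_aux
  mul_one := mul_one_aux

/-! ### Rank, domain, codomain, kernel, cokernel -/

/-- A set of points meets both rows. -/
def MeetsBothRows (B : Set (Fin n ⊕ Fin n)) : Prop :=
  (∃ i, Sum.inl i ∈ B) ∧ ∃ i, Sum.inr i ∈ B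

/-- The blocks of `α` that meet both rows. -/
def transversalBlocks (α : PartitionMonoid n) : Set (Set (Fin n ⊕ Fin n)) :=
  {B | B ∈ α.eqv.classes ∧ MeetsBothRows B}

/-- The rank of `α`: the number of its transversal blocks. -/
noncomputable def rank (α : PartitionMonoid n) : ℕ :=
  α.transversalBlocks.ncard

/-- The domain of `α`: the set of `i ∈ [n]` whose block meets `[n]'`. -/
def dom (α : PartitionMonoid n) : Set (Fin n) :=
  {i | ∃ k, α.eqv (Sum.inl i) (Sum.inr k)}

/-- The codomain of `α`: the set of `i ∈ [n]` such that the block of `i'` meets `[n]`. -/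
def codom (α : PartitionMonoid n) : Set (Fin n) :=
  {i | ∃ k, α.eqv (Sum.inr i) (Sum.inl k)}

/-- The kernel of `α`: the equivalence `i ~ k` if `i` and `k` lie in the same block. -/
def ker (α : PartitionMonoid n) : Setoid (Fin n) :=
  Setoid.comap Sum.inl α.eqv

/-- The cokernel of `α`: the equivalence `i ~ k` if `i'` and `k'` lie in the same block. -/
def coker (α : PartitionMonoid n) : Setoid (Fin n) :=
  Setoid.comap Sum.inr α.eqv

/-! ### The ideals -/

theorem dom_mul_subset (α β : PartitionMonoid n) : (α * β).dom ⊆ α.dom := by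
  rintro i ⟨k, hk⟩
  by_contra hi
  let N : Fin n ⊕ (Fin n ⊕ Fin n) → Prop :=
    Sum.elim (fun x => α.eqv (Sum.inl x) (Sum.inl i)) (fun _ => False)
  have hα : ∀ x, N (upperRows x) ↔ α.eqv x (Sum.inl i) := by
    rintro (x | x)
    · exact Iff.rfl
    · exact ⟨False.elim, fun h => hi ⟨x, α.eqv.symm' h⟩⟩
  have key : stack α β ≤ Setoid.ker N := by
    refine sup_le (setoid_map_le.2 ?_) (setoid_map_le.2 ?_)
    · intro x y hxy
      refine propext ?_
      rw [hα, hα]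
      exact ⟨fun h => Setoid.trans' _ (Setoid.symm' _ hxy) h, fun h => Setoid.trans' _ hxy h⟩
    · rintro (x | x) (y | y) _ <;> rfl
  have h : N (outerRows (.inl i)) = N (outerRows (.inr k)) := key hk
  exact (h ▸ (α.eqv.refl' (Sum.inl i) : N (outerRows (.inl i))) : N (outerRows (.inr k)))

theorem rank_mul_le_left (α β : PartitionMonoid n) : (α * β).rank ≤ α.rank := by
  have h1 : ∀ B ∈ (α * β).transversalBlocks, ∃ C ∈ α.transversalBlocks, ∃ i,
      C = {x | α.eqv x (Sum.inl i)} ∧ B = {x | (α * β).eqv x (Sum.inl i)} := by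
    rintro B ⟨⟨y, rfl⟩, ⟨i, hi⟩, ⟨k, hk⟩⟩
    have hi' : (α * β).eqv (Sum.inl i) y := hi
    have hk' : (α * β).eqv (Sum.inr k) y := hk
    obtain ⟨l, hl⟩ := dom_mul_subset α β ⟨k, Setoid.trans' _ hi' (Setoid.symm' _ hk')⟩
    refine ⟨_, ⟨⟨Sum.inl i, rfl⟩, ⟨i, α.eqv.refl' _⟩, ⟨l, α.eqv.symm' hl⟩⟩, i, rfl, ?_⟩
    ext x
    exact ⟨fun h => Setoid.trans' _ h (Setoid.symm' _ hi'),
      fun h => Setoid.trans' (α * β).eqv h hi'⟩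
  choose! f hf hfB using h1
  refine Set.ncard_le_ncard_of_injOn f hf ?_ (Set.toFinite _)
  intro B h C h' hBC
  obtain ⟨i, hi, hB⟩ := hfB B h
  obtain ⟨k, hk, hC⟩ := hfB C h'
  have h2 : (Sum.inl i : Fin n ⊕ Fin n) ∈ {x | α.eqv x (Sum.inl k)} := by
    rw [← hk, ← hBC, hi]
    exact α.eqv.refl' _
  have h3 : (α * β).eqv (Sum.inl i) (Sum.inl k) :=
    (le_sup_left : _ ≤ stack α β) (setoid_map_rel upperRows α.eqv h2)
  rw [hB, hC]
  ext x
  exact ⟨fun h => Setoid.trans' (α * β).eqv h h3,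
    fun h => Setoid.trans' _ h (Setoid.symm' _ h3)⟩

theorem star_star (α : PartitionMonoid n) : α.star.star = α := by
  apply PartitionMonoid.ext
  ext x y
  rcases x with x | x <;> rcases y with y | y <;> rfl

theorem star_mul (α β : PartitionMonoid n) : (α * β).star = β.star * α.star := by
  have key : ∀ α β : PartitionMonoid n, (β.star * α.star).eqv ≤ (α * β).star.eqv := by
    intro α β
    let c : Fin n ⊕ (Fin n ⊕ Fin n) → Fin n ⊕ (Fin n ⊕ Fin n) :=
      Sum.elim (Sum.inr ∘ Sum.inr) (Sum.elim (Sum.inr ∘ Sum.inl) Sum.inl)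
    have h : stack β.star α.star ≤ Setoid.comap c (stack α β) := by
      refine sup_le (setoid_map_le.2 ?_) (setoid_map_le.2 ?_)
      · intro x y hxy
        have := (le_sup_right : _ ≤ stack α β) (setoid_map_rel lowerRows β.eqv hxy)
        rcases x with x | x <;> rcases y with y | y <;> exact this
      · intro x y hxy
        have := (le_sup_left : _ ≤ stack α β) (setoid_map_rel upperRows α.eqv hxy)
        rcases x with x | x <;> rcases y with y | y <;> exact this
    intro x y hxy
    have := h hxy
    rcases x with x | x <;> rcases y with y | y <;> exact this
  apply PartitionMonoid.ext
  refine le_antisymm ?_ (key α β)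
  intro x y hxy
  have h := @key β.star α.star (Sum.swap x) (Sum.swap y)
  rw [star_star, star_star] at h
  have h' := h hxy
  rcases x with x | x <;> rcases y with y | y <;> exact h'

theorem rank_star_le (α : PartitionMonoid n) : α.star.rank ≤ α.rank := by
  refine Set.ncard_le_ncard_of_injOn (fun B => Sum.swap ⁻¹' B) ?_ ?_ (Set.toFinite _)
  · rintro B ⟨⟨y, rfl⟩, ⟨i, hi⟩, ⟨k, hk⟩⟩
    refine ⟨⟨Sum.swap y, ?_⟩, ⟨k, hk⟩, ⟨i, hi⟩⟩
    ext x
    change α.eqv (Sum.swap (Sum.swap x)) (Sum.swap y) ↔ α.eqv x (Sum.swap y)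
    rw [Sum.swap_swap]
  · intro B _ C _ h
    exact Set.preimage_injective.2 (Function.Involutive.surjective Sum.swap_swap) h

theorem rank_mul_le_right (α β : PartitionMonoid n) : (α * β).rank ≤ β.rank := by
  calc (α * β).rank = (α * β).star.star.rank := by rw [star_star]
    _ ≤ (α * β).star.rank := rank_star_le _
    _ = (β.star * α.star).rank := by rw [star_mul]
    _ ≤ β.star.rank := rank_mul_le_left _ _
    _ ≤ β.rank := rank_star_le _

/-- The ideal `I_r(𝒫ₙ)` of all partitions of rank at most `r`, as a semigroup. -/
def ideal (n r : ℕ) : Subsemigroup (PartitionMonoid n) where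
  carrier := {α | α.rank ≤ r}
  mul_mem' := fun {α β} hα _ => le_trans (rank_mul_le_left α β) hα

/-- `ideal n r` is indeed a two-sided ideal of the partition monoid. -/
theorem mul_mem_ideal {r : ℕ} {α : PartitionMonoid n} (hα : α ∈ ideal n r)
    (β : PartitionMonoid n) : α * β ∈ ideal n r ∧ β * α ∈ ideal n r :=
  ⟨le_trans (rank_mul_le_left α β) hα, le_trans (rank_mul_le_right β α) hα⟩

/-! ### Generating sets of semigroups -/

/-- The semigroup `S` is generated by its idempotents. -/
def IsIdempotentGenerated {M : Type*} [Semigroup M] (S : Subsemigroup M) : Prop :=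
  Subsemigroup.closure {e | e ∈ S ∧ IsIdempotentElem e} = S

/-- The rank of a (finitely generated) semigroup `S`: the least cardinality of a generating set. -/
noncomputable def semigroupRank {M : Type*} [Semigroup M] (S : Subsemigroup M) : ℕ :=
  sInf {k | ∃ A : Finset M, Subsemigroup.closure (A : Set M) = S ∧ A.card = k}

/-- The idempotent rank of a (finitely generated, idempotent generated) semigroup `S`: the least
cardinality of a generating set consisting of idempotents. -/
noncomputable def semigroupIdempotentRank {M : Type*} [Semigroup M] (S : Subsemigroup M) : ℕ :=
  sInf {k | ∃ A : Finset M, (∀ e ∈ A, IsIdempotentElem e) ∧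
    Subsemigroup.closure (A : Set M) = S ∧ A.card = k}

end PartitionMonoid

/-! A partition of rank `r` consists of an upper and a lower row, each an equivalence relation with
`r` distinguished classes, together with a matching of these classes (`exists_eq_glue`). The
projection `α * α.star` remembers exactly the upper row, that is `α.ker` and `α.dom`, and `α.star *
α` the lower one. So `α` acts as an arrow between projections of rank `r`, and arrows compose within
rank `r` whenever target and source agree.

Lower bound: if a projection `p` of rank `r` is a product of generators, its first factor `a` has
rank `r` and `a * a.star` fixes `p` from the left. Comparable projections of equal rank coincide
(`eq_of_mul_eq_of_mem_projections`), so `a * a.star = p`. Hence a generating set needs at least as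
many elements as there are projections of rank `r`. The projections themselves suffice
(`closure_projections`): since `r < n`, labels can be moved around as in a sliding puzzle, which
reaches every partition of rank `r`, and each lower rank is reached from the rank above it.

For a set of the minimal size, conditions (2) and (3) say that `α ↦ α * α.star` and `α ↦ α.star * α`
are injective. Generation forces this by counting. Conversely, the elements of the set then define a
permutation of the projections; following a cycle yields an element with the same source and target,
one of whose powers is the projection (`projections_subset_closure`).

A projection amounts to an equivalence relation with `r` chosen classes, which gives the Stirling
sum (`ncard_projections`). The Bell number form satisfies the same recurrence
(`sum_stirlingSecond_choose_eq_range`). -/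

namespace PartitionMonoid

variable {n : ℕ}

/-! ### Computing products -/

theorem stack_upper {α β : PartitionMonoid n} {x y : Fin n ⊕ Fin n} (h : α.eqv x y) :
    stack α β (upperRows x) (upperRows y) :=
  (le_sup_left : _ ≤ stack α β) (setoid_map_rel upperRows α.eqv h)

theorem stack_lower {α β : PartitionMonoid n} {x y : Fin n ⊕ Fin n} (h : β.eqv x y) :
    stack α β (lowerRows x) (lowerRows y) :=
  (le_sup_right : _ ≤ stack α β) (setoid_map_rel lowerRows β.eqv h)

/-- To identify a product `α * β` with `γ`, send each point `m` of the middle row to an outer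
point `g m` in a way compatible with `α`, `β` and `γ`. -/
theorem mul_eq_of_retract {α β γ : PartitionMonoid n} (g : Fin n → Fin n ⊕ Fin n)
    (hα : α.eqv ≤ Setoid.comap (Sum.elim Sum.inl g) γ.eqv)
    (hβ : β.eqv ≤ Setoid.comap (Sum.elim g Sum.inr) γ.eqv)
    (hγ : ∀ x y, γ.eqv x y → stack α β (outerRows x) (outerRows y)) : α * β = γ := by
  apply PartitionMonoid.ext
  rw [mul_eqv]
  refine le_antisymm ?_ fun x y h => hγ x y h
  have h : stack α β ≤ Setoid.comap (Sum.elim Sum.inl (Sum.elim g Sum.inr)) γ.eqv := by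
    refine sup_le (setoid_map_le.2 ?_) (setoid_map_le.2 ?_)
    · rintro (x | x) (y | y) hxy <;> exact hα hxy
    · rintro (x | x) (y | y) hxy <;> exact hβ hxy
  rintro (x | x) (y | y) hxy <;> exact h hxy

/-! ### Half diagrams -/

/-- One row of a partition: an equivalence relation on `[n]` together with distinct classes
labelled by `X`, each given by a representative. -/
structure HalfDiagram (n : ℕ) (X : Type*) where
  /-- the equivalence relation -/
  rel : Setoid (Fin n)
  /-- a representative of the class with the given label -/
  pt : X → Fin n
  sep : ∀ x y, rel (pt x) (pt y) → x = y

variable {X Y : Type*}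

/-- The partition whose rows are the half diagrams `P` and `Q`, classes with the same label being
joined. -/
def glue (P Q : HalfDiagram n X) : PartitionMonoid n where
  eqv :=
    { r := fun p q => match p, q with
        | .inl i, .inl j => P.rel i j
        | .inr i, .inr j => Q.rel i j
        | .inl i, .inr j => ∃ x, P.rel i (P.pt x) ∧ Q.rel j (Q.pt x)
        | .inr i, .inl j => ∃ x, P.rel j (P.pt x) ∧ Q.rel i (Q.pt x)
      iseqv := by
        have hP := P.sep
        have hQ := Q.sep
        have sP : ∀ {i j}, P.rel i j → P.rel j i := P.rel.symm'
        have sQ : ∀ {i j}, Q.rel i j → Q.rel j i := Q.rel.symm'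
        have tP : ∀ {i j k}, P.rel i j → P.rel j k → P.rel i k := P.rel.trans'
        have tQ : ∀ {i j k}, Q.rel i j → Q.rel j k → Q.rel i k := Q.rel.trans'
        refine ⟨?_, ?_, ?_⟩
        · rintro (i | i)
          · exact P.rel.refl' i
          · exact Q.rel.refl' i
        · rintro (i | i) (j | j) h
          · exact sP h
          · exact h
          · exact h
          · exact sQ h
        · rintro (i | i) (j | j) (k | k) h h'
          · exact tP h h'
          · obtain ⟨x, h1, h2⟩ := h'
            exact ⟨x, tP h h1, h2⟩
          · obtain ⟨x, h1, h2⟩ := h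
            obtain ⟨y, h3, h4⟩ := h'
            obtain rfl := hQ x y (tQ (sQ h2) h4)
            exact tP h1 (sP h3)
          · obtain ⟨x, h1, h2⟩ := h
            exact ⟨x, h1, tQ (sQ h') h2⟩
          · obtain ⟨x, h1, h2⟩ := h
            exact ⟨x, tP (sP h') h1, h2⟩
          · obtain ⟨x, h1, h2⟩ := h
            obtain ⟨y, h3, h4⟩ := h'
            obtain rfl := hP x y (tP (sP h1) h3)
            exact tQ h2 (sQ h4)
          · obtain ⟨x, h1, h2⟩ := h'
            exact ⟨x, h1, tQ h h2⟩
          · exact tQ h h' }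

theorem glue_inl_inl {P Q : HalfDiagram n X} {i j : Fin n} :
    (glue P Q).eqv (.inl i) (.inl j) ↔ P.rel i j := Iff.rfl

theorem glue_inr_inr {P Q : HalfDiagram n X} {i j : Fin n} :
    (glue P Q).eqv (.inr i) (.inr j) ↔ Q.rel i j := Iff.rfl

theorem glue_pt {P Q : HalfDiagram n X} (x : X) :
    (glue P Q).eqv (.inl (P.pt x)) (.inr (Q.pt x)) :=
  ⟨x, P.rel.refl' _, Q.rel.refl' _⟩

/-- Two partitions agree as soon as they agree on pairs of upper points, pairs of lower points, and
pairs of an upper and a lower point. -/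
theorem eq_of_rows {α β : PartitionMonoid n}
    (h1 : ∀ i j, α.eqv (.inl i) (.inl j) ↔ β.eqv (.inl i) (.inl j))
    (h2 : ∀ i j, α.eqv (.inr i) (.inr j) ↔ β.eqv (.inr i) (.inr j))
    (h3 : ∀ i j, α.eqv (.inl i) (.inr j) ↔ β.eqv (.inl i) (.inr j)) : α = β := by
  apply PartitionMonoid.ext
  ext x y
  rcases x with i | i <;> rcases y with j | j
  · exact h1 i j
  · exact h3 i j
  · rw [Setoid.comm', h3, Setoid.comm']
  · exact h2 i j

theorem glue_star (P Q : HalfDiagram n X) : (glue P Q).star = glue Q P := by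
  refine eq_of_rows (fun i j => Iff.rfl) (fun i j => Iff.rfl) fun i j => ?_
  exact exists_congr fun _ => and_comm

theorem ker_glue (P Q : HalfDiagram n X) : (glue P Q).ker = P.rel := rfl

theorem dom_glue (P Q : HalfDiagram n X) : (glue P Q).dom = {i | ∃ x, P.rel i (P.pt x)} := by
  ext i
  constructor
  · rintro ⟨k, x, h, -⟩
    exact ⟨x, h⟩
  · rintro ⟨x, h⟩
    exact ⟨Q.pt x, x, h, Q.rel.refl' _⟩

theorem glue_self_inl_inr (P : HalfDiagram n X) (i j : Fin n) :
    (glue P P).eqv (.inl i) (.inr j) ↔ P.rel i j ∧ ∃ x, P.rel i (P.pt x) := by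
  constructor
  · rintro ⟨x, h1, h2⟩
    exact ⟨P.rel.trans' h1 (P.rel.symm' h2), x, h1⟩
  · rintro ⟨h1, x, h2⟩
    exact ⟨x, h2, P.rel.trans' (P.rel.symm' h1) h2⟩

/-- The partition `glue P P` depends only on the relation and the set of labelled points. -/
theorem glue_self_congr {P : HalfDiagram n X} {Q : HalfDiagram n Y} (h : P.rel = Q.rel)
    (h' : ∀ i, (∃ x, P.rel i (P.pt x)) ↔ ∃ y, Q.rel i (Q.pt y)) : glue P P = glue Q Q := by
  refine eq_of_rows (fun i j => ?_) (fun i j => ?_) fun i j => ?_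
  · rw [glue_inl_inl, glue_inl_inl, h]
  · rw [glue_inr_inr, glue_inr_inr, h]
  · rw [glue_self_inl_inr, glue_self_inl_inr, h, ← h', h]

/-- Multiplication of glued half diagrams when the two middle rows have a common coarsening that
keeps the labels apart. -/
theorem glue_mul_glue {P Q R S : HalfDiagram n X} (J : Setoid (Fin n)) (hQ : Q.rel ≤ J)
    (hR : R.rel ≤ J) (hJ : ∀ x y, J (Q.pt x) (Q.pt y) → x = y)
    (hm : ∀ x, ∃ k, Q.rel k (Q.pt x) ∧ R.rel k (R.pt x)) :
    glue P Q * glue R S = glue P S := by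
  classical
  have hQR : ∀ x, J (Q.pt x) (R.pt x) := fun x => by
    obtain ⟨k, h1, h2⟩ := hm x
    exact J.trans' (J.symm' (hQ h1)) (hR h2)
  let g : Fin n → Fin n ⊕ Fin n := fun m =>
    -- Middle points in an unlabelled class of `J` are joined to neither outer row, so their image
    -- is immaterial as long as it is constant on classes. The chosen default does not depend on
    -- `m`, by proof irrelevance.
    if h : ∃ x, J m (Q.pt x) then .inl (P.pt h.choose) else .inl (Classical.choice ⟨m⟩)
  have g1 : ∀ {m x}, J m (Q.pt x) → g m = .inl (P.pt x) := by
    intro m x h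
    have h' : ∃ x, J m (Q.pt x) := ⟨x, h⟩
    simp only [g, dif_pos h']
    rw [hJ _ _ (J.trans' (J.symm' h'.choose_spec) h)]
  have g2 : ∀ {m m'}, J m m' → g m = g m' := by
    intro m m' h
    by_cases h' : ∃ x, J m (Q.pt x)
    · obtain ⟨x, hx⟩ := h'
      rw [g1 hx, g1 (J.trans' (J.symm' h) hx)]
    · have h'' : ¬ ∃ x, J m' (Q.pt x) := fun ⟨x, hx⟩ => h' ⟨x, J.trans' h hx⟩
      simp only [g, dif_neg h', dif_neg h'']
  refine mul_eq_of_retract g ?_ ?_ ?_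
  · have key : ∀ i m, (glue P Q).eqv (.inl i) (.inr m) → (glue P S).eqv (.inl i) (g m) := by
      rintro i m ⟨x, h1, h2⟩
      rw [g1 (hQ h2)]
      exact h1
    rintro (i | i) (j | j) h
    · exact h
    · exact key i j h
    · exact Setoid.symm' _ (key j i (Setoid.symm' _ h))
    · change (glue P S).eqv (g i) (g j)
      rw [g2 (hQ h)]
  · have key : ∀ m j, (glue R S).eqv (.inl m) (.inr j) → (glue P S).eqv (g m) (.inr j) := by
      rintro m j ⟨x, h1, h2⟩
      rw [g1 (J.trans' (hR h1) (J.symm' (hQR x)))]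
      exact ⟨x, P.rel.refl' _, h2⟩
    rintro (i | i) (j | j) h
    · change (glue P S).eqv (g i) (g j)
      rw [g2 (hR h)]
    · exact key i j h
    · exact Setoid.symm' _ (key j i (Setoid.symm' _ h))
    · exact h
  · have key : ∀ i j, (glue P S).eqv (.inl i) (.inr j) →
        stack (glue P Q) (glue R S) (.inl i) (.inr (.inr j)) := by
      rintro i j ⟨x, h1, h2⟩
      obtain ⟨k, h3, h4⟩ := hm x
      have a : (glue P Q).eqv (.inl i) (.inr k) := ⟨x, h1, h3⟩
      have b : (glue R S).eqv (.inl k) (.inr j) := ⟨x, h4, h2⟩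
      exact Setoid.trans' _ (stack_upper a) (stack_lower b)
    rintro (i | i) (j | j) h
    · exact stack_upper (x := .inl i) (y := .inl j) h
    · exact key i j h
    · exact Setoid.symm' _ (key j i (Setoid.symm' _ h))
    · exact stack_lower (x := .inr i) (y := .inr j) h

theorem glue_mul_glue_self (P Q S : HalfDiagram n X) : glue P Q * glue Q S = glue P S :=
  glue_mul_glue Q.rel le_rfl le_rfl Q.sep fun _ => ⟨_, Q.rel.refl' _, Q.rel.refl' _⟩

theorem rank_glue (P Q : HalfDiagram n X) : (glue P Q).rank = Nat.card X := by
  have h : (glue P Q).transversalBlocks =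
      Set.range fun x => {y | (glue P Q).eqv y (.inl (P.pt x))} := by
    ext B
    constructor
    · rintro ⟨⟨y, rfl⟩, ⟨i, hi⟩, ⟨k, hk⟩⟩
      obtain ⟨x, h1, h2⟩ : (glue P Q).eqv (.inl i) (.inr k) :=
        Setoid.trans' _ hi (Setoid.symm' _ hk)
      have h3 : (glue P Q).eqv y (.inl (P.pt x)) := by
        have h1' : (glue P Q).eqv (.inl i) (.inl (P.pt x)) := h1
        exact Setoid.trans' _ (Setoid.symm' _ hi) h1'
      refine ⟨x, ?_⟩
      ext z
      exact ⟨fun h => Setoid.trans' (glue P Q).eqv h (Setoid.symm' _ h3),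
        fun h => Setoid.trans' (glue P Q).eqv h h3⟩
    · rintro ⟨x, rfl⟩
      exact ⟨⟨_, rfl⟩, ⟨P.pt x, P.rel.refl' _⟩, ⟨Q.pt x, Setoid.symm' _ (glue_pt x)⟩⟩
  rw [rank, h, Set.ncard_range_of_injective]
  intro x y hxy
  have h1 : (.inl (P.pt x) : Fin n ⊕ Fin n) ∈ {z | (glue P Q).eqv z (.inl (P.pt y))} := by
    rw [← show {z | (glue P Q).eqv z (.inl (P.pt x))} =
      {z | (glue P Q).eqv z (.inl (P.pt y))} from hxy]
    exact P.rel.refl' (P.pt x)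
  exact P.sep x y h1

/-- Every partition of rank `r` is obtained by gluing half diagrams with `r` labels. -/
theorem exists_eq_glue (α : PartitionMonoid n) :
    ∃ P Q : HalfDiagram n (Fin α.rank), α = glue P Q := by
  have hfin : Finite α.transversalBlocks := Set.toFinite _
  have e : Fin α.rank ≃ α.transversalBlocks := (Finite.equivFinOfCardEq rfl).symm
  have hB : ∀ x : Fin α.rank, ∃ y i k, (e x : Set (Fin n ⊕ Fin n)) = {z | α.eqv z y} ∧
      α.eqv (.inl i) y ∧ α.eqv (.inr k) y := by
    intro x
    obtain ⟨⟨y, hy⟩, ⟨i, hi⟩, ⟨k, hk⟩⟩ := (e x).2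
    rw [hy] at hi hk
    exact ⟨y, i, k, hy, hi, hk⟩
  choose y t u hy ht hu using hB
  have sep : ∀ a b, α.eqv (y a) (y b) → a = b := by
    intro a b h
    apply e.injective
    apply Subtype.ext
    rw [hy, hy]
    ext z
    exact ⟨fun h' => Setoid.trans' α.eqv h' h, fun h' => Setoid.trans' α.eqv h' (Setoid.symm' _ h)⟩
  refine ⟨⟨α.ker, t, fun a b h => sep a b ?_⟩, ⟨α.coker, u, fun a b h => sep a b ?_⟩, ?_⟩
  · exact Setoid.trans' _ (Setoid.symm' _ (ht a)) (Setoid.trans' _ h (ht b))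
  · exact Setoid.trans' _ (Setoid.symm' _ (hu a)) (Setoid.trans' _ h (hu b))
  refine eq_of_rows (fun i j => Iff.rfl) (fun i j => Iff.rfl) fun i j => ?_
  constructor
  · intro h
    let B : α.transversalBlocks := ⟨{z | α.eqv z (.inl i)}, ⟨_, rfl⟩, ⟨i, α.eqv.refl' _⟩,
      ⟨j, α.eqv.symm' h⟩⟩
    obtain ⟨x, hx⟩ := e.surjective B
    have h1 : α.eqv (.inl i) (y x) := by
      have : (.inl i : Fin n ⊕ Fin n) ∈ (e x : Set (Fin n ⊕ Fin n)) := by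
        rw [hx]; exact α.eqv.refl' _
      rw [hy] at this
      exact this
    refine ⟨x, ?_, ?_⟩
    · exact Setoid.trans' α.eqv h1 (Setoid.symm' _ (ht x))
    · exact Setoid.trans' α.eqv (Setoid.symm' _ h) (Setoid.trans' α.eqv h1 (Setoid.symm' _ (hu x)))
  · rintro ⟨x, h1, h2⟩
    have h1' : α.eqv (.inl i) (.inl (t x)) := h1
    have h2' : α.eqv (.inr j) (.inr (u x)) := h2
    exact Setoid.trans' _ h1' (Setoid.trans' _ (ht x) (Setoid.trans' _ (Setoid.symm' _ (hu x))
      (Setoid.symm' _ h2')))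

end PartitionMonoid

namespace PartitionMonoid

variable {n : ℕ} {X : Type*}

/-! ### Projections -/

theorem glue_mul_star (P Q : HalfDiagram n X) : glue P Q * (glue P Q).star = glue P P := by
  rw [glue_star, glue_mul_glue_self]

theorem mul_star_mul (α : PartitionMonoid n) : α * α.star * α = α := by
  obtain ⟨P, Q, h⟩ := exists_eq_glue α
  rw [h, glue_mul_star, glue_mul_glue_self]

theorem rank_star (α : PartitionMonoid n) : α.star.rank = α.rank :=
  le_antisymm (rank_star_le α) (by simpa only [star_star] using rank_star_le α.star)

/-- The projections of rank `r`. -/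
def projections (n r : ℕ) : Set (PartitionMonoid n) :=
  {p | ∃ α : PartitionMonoid n, α.rank = r ∧ α * α.star = p}

theorem mem_projections_iff {r : ℕ} {p : PartitionMonoid n} :
    p ∈ projections n r ↔ ∃ P : HalfDiagram n (Fin r), p = glue P P := by
  constructor
  · rintro ⟨α, rfl, rfl⟩
    obtain ⟨P, Q, h⟩ := exists_eq_glue α
    refine ⟨P, ?_⟩
    conv_lhs => rw [h]
    exact glue_mul_star P Q
  · rintro ⟨P, rfl⟩
    exact ⟨glue P P, by simp [rank_glue], glue_mul_star P P⟩

theorem star_eq_of_mem_projections {r : ℕ} {p : PartitionMonoid n} (hp : p ∈ projections n r) :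
    p.star = p := by
  obtain ⟨P, rfl⟩ := mem_projections_iff.1 hp
  exact glue_star P P

theorem isIdempotentElem_of_mem_projections {r : ℕ} {p : PartitionMonoid n}
    (hp : p ∈ projections n r) : IsIdempotentElem p := by
  obtain ⟨P, rfl⟩ := mem_projections_iff.1 hp
  exact glue_mul_glue_self P P P

theorem rank_of_mem_projections {r : ℕ} {p : PartitionMonoid n} (hp : p ∈ projections n r) :
    p.rank = r := by
  obtain ⟨P, rfl⟩ := mem_projections_iff.1 hp
  simp [rank_glue]

/-- Translates condition (2) into projections: `α * α.star` is the upper row of `α` glued to itself,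
so it carries the kernel and the labelled classes and nothing else. -/
theorem mul_star_eq_mul_star_iff {α β : PartitionMonoid n} :
    α * α.star = β * β.star ↔ α.ker = β.ker ∧ α.dom = β.dom := by
  obtain ⟨P, Q, h⟩ := exists_eq_glue α
  obtain ⟨R, S, h'⟩ := exists_eq_glue β
  have hα : α * α.star = glue P P := by conv_lhs => rw [h, glue_mul_star]
  have hβ : β * β.star = glue R R := by conv_lhs => rw [h', glue_mul_star]
  have kα : α.ker = (glue P P).ker := by conv_lhs => rw [h, ker_glue, ← ker_glue P P]
  have kβ : β.ker = (glue R R).ker := by conv_lhs => rw [h', ker_glue, ← ker_glue R R]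
  have dα : α.dom = (glue P P).dom := by conv_lhs => rw [h, dom_glue, ← dom_glue P P]
  have dβ : β.dom = (glue R R).dom := by conv_lhs => rw [h', dom_glue, ← dom_glue R R]
  rw [hα, hβ, kα, kβ, dα, dβ]
  constructor
  · intro e
    rw [e]
    exact ⟨rfl, rfl⟩
  · rintro ⟨e1, e2⟩
    refine glue_self_congr e1 fun i => ?_
    rw [dom_glue, dom_glue] at e2
    exact Set.ext_iff.1 e2 i

theorem star_mul_eq_star_mul_iff {α β : PartitionMonoid n} :
    α.star * α = β.star * β ↔ α.coker = β.coker ∧ α.codom = β.codom := by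
  have h := mul_star_eq_mul_star_iff (α := α.star) (β := β.star)
  rw [star_star, star_star] at h
  exact h

/-! ### Generation by projections -/

/-- The half diagram with singleton classes only, some of them labelled. -/
def discrete (t : X → Fin n) (ht : Function.Injective t) : HalfDiagram n X :=
  ⟨⊥, t, fun _ _ h => ht h⟩

/-- Right multiplication by the projection `glue R R` replaces the lower row `Q` by `R`. This is the
only move used to reach all partitions of rank `r`. -/
theorem glue_mem_closure_step {r : ℕ} {P Q R : HalfDiagram n (Fin r)}
    (h : glue P Q ∈ Subsemigroup.closure (projections n r)) (J : Setoid (Fin n))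
    (hQ : Q.rel ≤ J) (hR : R.rel ≤ J) (hJ : ∀ x y, J (Q.pt x) (Q.pt y) → x = y)
    (hm : ∀ x, ∃ k, Q.rel k (Q.pt x) ∧ R.rel k (R.pt x)) :
    glue P R ∈ Subsemigroup.closure (projections n r) := by
  rw [← glue_mul_glue J hQ hR hJ hm]
  exact Subsemigroup.mul_mem _ h (Subsemigroup.subset_closure (mem_projections_iff.2 ⟨R, rfl⟩))

/-- Moving one label of a discrete half diagram to an unlabelled point. -/
theorem glue_mem_closure_update {r : ℕ} {P : HalfDiagram n (Fin r)} {t : Fin r → Fin n}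
    (ht : Function.Injective t)
    (h : glue P (discrete t ht) ∈ Subsemigroup.closure (projections n r)) (i : Fin r) (b : Fin n)
    (hb : ∀ x, t x ≠ b) :
    ∃ ht' : Function.Injective (Function.update t i b),
      glue P (discrete _ ht') ∈ Subsemigroup.closure (projections n r) := by
  have ht' : Function.Injective (Function.update t i b) := by
    intro x y hxy
    by_cases hx : x = i <;> by_cases hy : y = i <;> simp [hx, hy] at hxy ⊢
    · exact absurd hxy.symm (hb y)
    · exact absurd hxy (hb x)
    · exact ht hxy
  refine ⟨ht', ?_⟩
  -- The kernel of `f` joins `b` to `t i` and nothing else. The label `i` is first spread over the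
  -- class of both points, now represented by `b`, and the class is then split with the label left
  -- at `b`. As `b` is unlabelled, no two labels ever meet.
  let f : Fin n → Fin n := Function.update id b (t i)
  have f1 : ∀ x, f (t x) = t x := fun x => by simp [f, hb x]
  have f2 : ∀ x, f (Function.update t i b x) = t x := by
    intro x
    by_cases hx : x = i
    · subst hx; simp [f]
    · simp [f, hx, hb x]
  let R : HalfDiagram n (Fin r) := ⟨Setoid.ker f, Function.update t i b, fun x y hxy => by
    have : f _ = f _ := hxy
    rw [f2, f2] at this
    exact ht this⟩
  have hR : glue P R ∈ Subsemigroup.closure (projections n r) := by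
    refine glue_mem_closure_step h (Setoid.ker f) bot_le le_rfl ?_ fun x => ⟨t x, rfl, ?_⟩
    · intro x y hxy
      have : f (t x) = f (t y) := hxy
      rw [f1, f1] at this
      exact ht this
    · change f (t x) = f _
      rw [f1, f2]
  exact glue_mem_closure_step hR (Setoid.ker f) le_rfl bot_le R.sep
    fun x => ⟨_, Setoid.refl' _ _, rfl⟩

/-- A sliding puzzle, by induction on the number of misplaced labels. If the destination of a
misplaced label is free, move the label there. If it is occupied by the label `j`, then `j` is
misplaced too, and moving it to a free point, which exists because `r < n`, does not increase the
count. -/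
theorem glue_discrete_mem_closure {r : ℕ} (hr : r < n) {P : HalfDiagram n (Fin r)}
    {u : Fin r → Fin n} (hu : Function.Injective u) (k : ℕ) :
    ∀ {t : Fin r → Fin n} (ht : Function.Injective t),
      (Finset.univ.filter fun x => t x ≠ u x).card = k →
      glue P (discrete t ht) ∈ Subsemigroup.closure (projections n r) →
      glue P (discrete u hu) ∈ Subsemigroup.closure (projections n r) := by
  induction k using Nat.strong_induction_on with
  | _ k ih =>
    intro t ht hk h
    by_cases htu : t = u
    · subst htu
      exact h
    obtain ⟨i, hi⟩ := Function.ne_iff.1 htu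
    -- it suffices to reach an injection that leaves `u i` unlabelled
    have main : ∀ {t : Fin r → Fin n} (ht : Function.Injective t),
        (Finset.univ.filter fun x => t x ≠ u x).card ≤ k → t i ≠ u i → (∀ x, t x ≠ u i) →
        glue P (discrete t ht) ∈ Subsemigroup.closure (projections n r) →
        glue P (discrete u hu) ∈ Subsemigroup.closure (projections n r) := by
      intro t ht hk hi hfree h
      obtain ⟨ht', h'⟩ := glue_mem_closure_update ht h i (u i) hfree
      refine ih _ (lt_of_lt_of_le ?_ hk) ht' rfl h'
      refine Finset.card_lt_card (Finset.ssubset_iff_of_subset ?_ |>.2 ⟨i, ?_, ?_⟩)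
      · intro x hx
        by_cases hxi : x = i
        · simp [hxi] at hx
        · simpa [Function.update_apply, hxi] using hx
      · simpa using hi
      · simp
    by_cases hfree : ∀ x, t x ≠ u i
    · exact main ht hk.le hi hfree h
    push Not at hfree
    obtain ⟨j, hj⟩ := hfree
    obtain ⟨b, hb⟩ : ∃ b, ∀ x, t x ≠ b := by
      by_contra! hc
      have := Fintype.card_le_of_surjective t hc
      simp at this
      omega
    have hji : j ≠ i := fun e => hi (e ▸ hj)
    obtain ⟨ht', h'⟩ := glue_mem_closure_update ht h j b hb
    refine main ht' ?_ ?_ ?_ h'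
    · rw [← hk]
      refine Finset.card_le_card fun x hx => ?_
      by_cases hxj : x = j
      · subst hxj
        simp only [Finset.mem_filter, Finset.mem_univ, true_and]
        rw [hj]
        exact fun e => hji (hu e).symm
      · simpa [Function.update_apply, hxj] using hx
    · simpa [Function.update_apply, hji.symm] using hi
    · intro x
      by_cases hxj : x = j
      · subst hxj
        rw [Function.update_self, ← hj]
        exact (hb x).symm
      · rw [Function.update_of_ne hxj, ← hj]
        exact fun e => hxj (ht e)

theorem HalfDiagram.pt_injective (P : HalfDiagram n X) : Function.Injective P.pt :=
  fun x y h => P.sep x y (h ▸ P.rel.refl' _)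

/-- For `r < n`, every partition of rank `r` is a product of projections of rank `r`. -/
theorem mem_closure_projections_of_rank_eq {r : ℕ} (hr : r < n) {α : PartitionMonoid n}
    (hα : α.rank = r) : α ∈ Subsemigroup.closure (projections n r) := by
  subst hα
  obtain ⟨P, Q, h⟩ := exists_eq_glue α
  suffices h3 : glue P Q ∈ Subsemigroup.closure (projections n α.rank) by rwa [← h] at h3
  -- The lower row passes from `P` to singletons at the representatives of `P`, then to those of
  -- `Q`, and finally to `Q`.
  have h0 : glue P P ∈ Subsemigroup.closure (projections n α.rank) :=
    Subsemigroup.subset_closure (mem_projections_iff.2 ⟨P, rfl⟩)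
  have h1 : glue P (discrete P.pt P.pt_injective) ∈ Subsemigroup.closure (projections n α.rank) :=
    glue_mem_closure_step h0 P.rel le_rfl bot_le P.sep fun x => ⟨_, P.rel.refl' _, rfl⟩
  have h2 := glue_discrete_mem_closure hr Q.pt_injective _ P.pt_injective rfl h1
  exact glue_mem_closure_step h2 Q.rel bot_le le_rfl Q.sep fun x => ⟨_, rfl, Q.rel.refl' _⟩

/-! ### Lowering the rank -/

theorem exists_two_not_mem_range {s : ℕ} (hs : s + 1 < n) (t : Fin s → Fin n) :
    ∃ u v, u ≠ v ∧ (∀ x, t x ≠ u) ∧ ∀ x, t x ≠ v := by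
  have h : 1 < ((Finset.univ.image t)ᶜ).card := by
    rw [Finset.card_compl, Fintype.card_fin]
    have : (Finset.univ.image t).card ≤ s := by
      simpa using Finset.card_image_le (s := Finset.univ) (f := t)
    omega
  obtain ⟨u, hu, v, hv, huv⟩ := Finset.one_lt_card.1 h
  exact ⟨u, v, huv, by simpa using hu, by simpa using hv⟩

theorem elim_injective {t : X → Fin n} (ht : Function.Injective t) {u : Fin n}
    (hu : ∀ x, t x ≠ u) : Function.Injective fun o : Option X => o.elim u t := by
  rintro (_ | x) (_ | y) h
  · rfl
  · exact absurd h.symm (hu y)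
  · exact absurd h (hu x)
  · exact congrArg some (ht h)

/-- An extra strand leads from the unlabelled class of `y` to `u`, where it ends, because `u` is an
unlabelled singleton of `C`. The extra label of `C` sits at `v`, which the first factor leaves
unlabelled. -/
theorem glue_discrete_eq_mul_of_unlabelled {P : HalfDiagram n X} {t : X → Fin n}
    (ht : Function.Injective t) {u v y : Fin n} (huv : u ≠ v) (hu : ∀ x, t x ≠ u)
    (hv : ∀ x, t x ≠ v) (hy : ∀ x, ¬ P.rel y (P.pt x)) :
    ∃ (A B C : HalfDiagram n (Option X)), glue P (discrete t ht) = glue A B * glue C C := by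
  classical
  let A : HalfDiagram n (Option X) := ⟨P.rel, fun o => o.elim y P.pt, by
    rintro (_ | a) (_ | b) h
    · rfl
    · exact absurd h (hy b)
    · exact absurd (P.rel.symm' h) (hy a)
    · exact congrArg some (P.sep a b h)⟩
  refine ⟨A, discrete _ (elim_injective ht hu), discrete _ (elim_injective ht hv), ?_⟩
  let g : Fin n → Fin n ⊕ Fin n := fun m => if m = u then .inl y else .inr m
  have g1 : g u = .inl y := if_pos rfl
  have g2 : ∀ {m}, m ≠ u → g m = .inr m := fun h => if_neg h
  symm
  refine mul_eq_of_retract g ?_ ?_ ?_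
  · have key : ∀ i m, (glue A (discrete _ (elim_injective ht hu))).eqv (.inl i) (.inr m) →
        (glue P (discrete t ht)).eqv (.inl i) (g m) := by
      rintro i m ⟨_ | x, h1, h2⟩
      · rw [show m = u from h2, g1]
        exact h1
      · rw [show m = t x from h2, g2 (hu x)]
        exact ⟨x, h1, rfl⟩
    rintro (i | i) (j | j) h
    · exact h
    · exact key i j h
    · exact Setoid.symm' _ (key j i (Setoid.symm' _ h))
    · obtain rfl : i = j := h
      exact Setoid.refl' _ _
  · have key : ∀ m j, (glue (discrete _ (elim_injective ht hv))
        (discrete _ (elim_injective ht hv))).eqv (.inl m) (.inr j) →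
        (glue P (discrete t ht)).eqv (g m) (.inr j) := by
      rintro m j ⟨x, h1, h2⟩
      have hx : x.elim v t ≠ u := by
        rcases x with _ | x
        · exact huv.symm
        · exact hu x
      rw [show m = x.elim v t from h1, show j = x.elim v t from h2, g2 hx]
    rintro (i | i) (j | j) h
    · obtain rfl : i = j := h
      exact Setoid.refl' _ _
    · exact key i j h
    · exact Setoid.symm' _ (key j i (Setoid.symm' _ h))
    · exact h
  · have key : ∀ i j, (glue P (discrete t ht)).eqv (.inl i) (.inr j) →
        stack (glue A (discrete _ (elim_injective ht hu))) (glue (discrete _ (elim_injective ht hv))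
        (discrete _ (elim_injective ht hv))) (.inl i) (.inr (.inr j)) := by
      rintro i j ⟨x, h1, h2⟩
      exact Setoid.trans' _ (stack_upper (x := .inl i) (y := .inr (t x)) ⟨some x, h1, rfl⟩)
        (stack_lower (x := .inl (t x)) (y := .inr j) ⟨some x, rfl, h2⟩)
    rintro (i | i) (j | j) h
    · exact stack_upper (x := .inl i) (y := .inl j) h
    · exact key i j h
    · exact Setoid.symm' _ (key j i (Setoid.symm' _ h))
    · exact stack_lower (x := .inr i) (y := .inr j) h

/-- The row `A` cuts `y` out of its class and sends it along a new strand to `u`. The row `C` joins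
`u` to `t a`, so that `y` is reattached to the class of `P.pt a` through the middle row. The extra
label of `C` at `v` only raises the rank. -/
theorem glue_discrete_eq_mul_of_labelled {P : HalfDiagram n X} {t : X → Fin n}
    (ht : Function.Injective t) {u v y : Fin n} (huv : u ≠ v) (hu : ∀ x, t x ≠ u)
    (hv : ∀ x, t x ≠ v) (hy : ∀ x, P.pt x ≠ y) {a : X} (ha : P.rel y (P.pt a)) :
    ∃ (A B C D : HalfDiagram n (Option X)), glue P (discrete t ht) = glue A B * glue C D := by
  classical
  let A : HalfDiagram n (Option X) := ⟨P.rel ⊓ Setoid.ker (· = y), fun o => o.elim y P.pt, by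
    rintro (_ | b) (_ | c) ⟨h, h'⟩
    · rfl
    · exact absurd ((iff_of_eq h').1 rfl) (hy c)
    · exact absurd ((iff_of_eq h').2 rfl) (hy b)
    · exact congrArg some (P.sep b c h)⟩
  let f : Fin n → Fin n := Function.update id u (t a)
  have f1 : f u = t a := by simp [f]
  have f2 : ∀ {m}, m ≠ u → f m = m := fun h => by simp [f, h]
  have f3 : ∀ o : Option X, f (o.elim v t) = o.elim v t := by
    rintro (_ | x)
    · exact f2 huv.symm
    · exact f2 (hu x)
  let C : HalfDiagram n (Option X) := ⟨Setoid.ker f, fun o => o.elim v t, by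
    intro o o' h
    have h' : f (o.elim v t) = f (o'.elim v t) := h
    rw [f3, f3] at h'
    exact elim_injective ht hv h'⟩
  refine ⟨A, discrete _ (elim_injective ht hu), C, discrete _ (elim_injective ht hv), ?_⟩
  symm
  refine mul_eq_of_retract (Sum.inr ∘ f) ?_ ?_ ?_
  · have key : ∀ i m, (glue A (discrete _ (elim_injective ht hu))).eqv (.inl i) (.inr m) →
        (glue P (discrete t ht)).eqv (.inl i) (.inr (f m)) := by
      rintro i m ⟨_ | x, h1, h2⟩
      · rw [show m = u from h2, f1]
        exact ⟨a, P.rel.trans' h1.1 ha, rfl⟩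
      · rw [show m = t x from h2, f2 (hu x)]
        exact ⟨x, h1.1, rfl⟩
    rintro (i | i) (j | j) h
    · exact h.1
    · exact key i j h
    · exact Setoid.symm' _ (key j i (Setoid.symm' _ h))
    · obtain rfl : i = j := h
      exact Setoid.refl' _ _
  · have key : ∀ m j, (glue C (discrete _ (elim_injective ht hv))).eqv (.inl m) (.inr j) →
        (glue P (discrete t ht)).eqv (.inr (f m)) (.inr j) := by
      rintro m j ⟨x, h1, h2⟩
      rw [show f m = f (x.elim v t) from h1, show j = x.elim v t from h2, f3]
    rintro (i | i) (j | j) h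
    · exact (h : f i = f j)
    · exact key i j h
    · exact Setoid.symm' _ (key j i (Setoid.symm' _ h))
    · exact h
  · let T := stack (glue A (discrete _ (elim_injective ht hu)))
      (glue C (discrete _ (elim_injective ht hv)))
    have top : ∀ {i j}, A.rel i j → T (.inl i) (.inl j) := fun {i j} h =>
      stack_upper (x := .inl i) (y := .inl j) h
    have cross : ∀ x, T (.inl (P.pt x)) (.inr (.inl (t x))) := fun x =>
      stack_upper (x := .inl (P.pt x)) (y := .inr (t x)) ⟨some x, A.rel.refl' _, rfl⟩
    have hya : T (.inl y) (.inl (P.pt a)) := by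
      refine T.trans' (y := .inr (.inl u)) ?_ (T.trans' (y := .inr (.inl (t a))) ?_
        (T.symm' (cross a)))
      · exact stack_upper (x := .inl y) (y := .inr u) ⟨none, A.rel.refl' _, rfl⟩
      · refine stack_lower (x := .inl u) (y := .inl (t a)) ?_
        change f u = f (t a)
        rw [f1, f2 (hu a)]
    have hyi : ∀ {i}, P.rel i y → T (.inl i) (.inl (P.pt a)) := by
      intro i h
      by_cases hi : i = y
      · rw [hi]; exact hya
      · exact top ⟨P.rel.trans' h ha, propext (iff_of_false hi (hy a))⟩
    have up : ∀ {i j}, P.rel i j → T (.inl i) (.inl j) := by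
      intro i j h
      by_cases hi : P.rel i y
      · exact T.trans' (hyi hi) (T.symm' (hyi (P.rel.trans' (P.rel.symm' h) hi)))
      · refine top ⟨h, propext (iff_of_false ?_ ?_)⟩
        · rintro rfl
          exact hi (P.rel.refl' _)
        · rintro rfl
          exact hi h
    have key : ∀ i j, (glue P (discrete t ht)).eqv (.inl i) (.inr j) →
        T (.inl i) (.inr (.inr j)) := by
      rintro i j ⟨x, h1, h2⟩
      exact T.trans' (up h1) (T.trans' (cross x)
        (stack_lower (x := .inl (t x)) (y := .inr j) ⟨some x, C.rel.refl' _, h2⟩))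
    rintro (i | i) (j | j) h
    · exact up h
    · exact key i j h
    · exact Setoid.symm' _ (key j i (Setoid.symm' _ h))
    · exact stack_lower (x := .inr i) (y := .inr j) h

theorem glue_discrete_eq_mul {s : ℕ} (hs : s + 1 < n) (P : HalfDiagram n (Fin s))
    {t : Fin s → Fin n} (ht : Function.Injective t) :
    ∃ β γ : PartitionMonoid n, β.rank = s + 1 ∧ γ.rank = s + 1 ∧
      glue P (discrete t ht) = β * γ := by
  obtain ⟨u, v, huv, hu, hv⟩ := exists_two_not_mem_range hs t
  by_cases h : ∃ y, ∀ x, ¬ P.rel y (P.pt x)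
  · obtain ⟨y, hy⟩ := h
    obtain ⟨A, B, C, h⟩ := glue_discrete_eq_mul_of_unlabelled ht huv hu hv hy
    exact ⟨_, _, by simp [rank_glue], by simp [rank_glue], h⟩
  · push Not at h
    -- Every class is now labelled; as there are fewer labels than points, some point is not a
    -- chosen representative and can be cut off its class.
    obtain ⟨y, -, -, hy, -⟩ := exists_two_not_mem_range hs P.pt
    obtain ⟨a, ha⟩ := h y
    obtain ⟨A, B, C, D, h⟩ := glue_discrete_eq_mul_of_labelled ht huv hu hv hy ha
    exact ⟨_, _, by simp [rank_glue], by simp [rank_glue], h⟩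

/-- For `s + 1 < n`, partitions of rank `s` are products of partitions of rank `s + 1`. -/
theorem mem_of_rank_succ {s : ℕ} (hs : s + 1 < n) {S : Subsemigroup (PartitionMonoid n)}
    (hS : ∀ β : PartitionMonoid n, β.rank = s + 1 → β ∈ S) {α : PartitionMonoid n}
    (hα : α.rank = s) : α ∈ S := by
  subst hα
  obtain ⟨P, Q, h⟩ := exists_eq_glue α
  obtain ⟨β, γ, hβ, hγ, e⟩ := glue_discrete_eq_mul hs P P.pt_injective
  obtain ⟨β', γ', hβ', hγ', e'⟩ := glue_discrete_eq_mul hs Q P.pt_injective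
  -- The partition factors through a discrete middle row. The first half is a product by `e`; the
  -- second is the reflection of a half of the same kind, to which `e'` applies.
  rw [h, ← glue_mul_glue_self P (discrete P.pt P.pt_injective) Q, e,
    ← glue_star Q (discrete P.pt P.pt_injective), e', star_mul]
  exact S.mul_mem (S.mul_mem (hS _ hβ) (hS _ hγ))
    (S.mul_mem (hS _ (by rw [rank_star, hγ'])) (hS _ (by rw [rank_star, hβ'])))

theorem closure_projections {r : ℕ} (hr : r < n) :
    Subsemigroup.closure (projections n r) = ideal n r := by
  refine le_antisymm (Subsemigroup.closure_le.2 fun p hp => (rank_of_mem_projections hp).le) ?_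
  -- Induction on the distance `k` of the rank below `r`.
  have key : ∀ k s, s + k = r → ∀ α : PartitionMonoid n, α.rank = s →
      α ∈ Subsemigroup.closure (projections n r) := by
    intro k
    induction k with
    | zero =>
      intro s hs α hα
      exact mem_closure_projections_of_rank_eq hr (hα.trans hs)
    | succ k ih =>
      intro s hs α hα
      exact mem_of_rank_succ (by omega) (ih (s + 1) (by omega)) hα
  intro α hα
  have hα' : α.rank ≤ r := hα
  exact key (r - α.rank) α.rank (by omega) α rfl

end PartitionMonoid

/-! ### Idempotent powers and products of generators -/

theorem exists_pow_isIdempotentElem {M : Type*} [Monoid M] [Finite M] (a : M) :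
    ∃ k, IsIdempotentElem (a ^ (k + 1)) := by
  obtain ⟨i, j, hij, h⟩ : ∃ i j, i < j ∧ a ^ (i + 1) = a ^ (j + 1) := by
    obtain ⟨i, j, hij, h⟩ := Finite.exists_ne_map_eq_of_infinite fun i : ℕ => a ^ (i + 1)
    rcases lt_or_gt_of_ne hij with h' | h'
    · exact ⟨i, j, h', h⟩
    · exact ⟨j, i, h', h.symm⟩
  obtain ⟨p, rfl⟩ := Nat.exists_eq_add_of_lt hij
  have h1 : ∀ q, a ^ (i + 1) = a ^ (i + 1 + q * (p + 1)) := by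
    intro q
    induction q with
    | zero => simp
    | succ q ih =>
      calc a ^ (i + 1) = a ^ (i + 1 + (p + 1)) := by rw [h]; congr 1; ring
        _ = a ^ (i + 1) * a ^ (p + 1) := pow_add _ _ _
        _ = a ^ (i + 1 + q * (p + 1)) * a ^ (p + 1) := by rw [← ih]
        _ = a ^ (i + 1 + (q + 1) * (p + 1)) := by rw [← pow_add]; congr 1; ring
  -- The exponent is then `(i + 1) * (p + 1)`: a multiple of the period `p + 1`, and at least `i +
  -- 1`, where periodicity sets in.
  refine ⟨i * p + i + p, ?_⟩
  have e : i * p + i + p + 1 = (i + 1) + (i + 1) * p := by ring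
  have e' : i * p + i + p + 1 = (i + 1) * (p + 1) := by ring
  calc a ^ (i * p + i + p + 1) * a ^ (i * p + i + p + 1)
      = a ^ ((i + 1) + (i + 1) * (p + 1)) * a ^ ((i + 1) * p) := by
        rw [← pow_add, ← pow_add]; congr 1; ring
    _ = a ^ (i + 1) * a ^ ((i + 1) * p) := by rw [← h1]
    _ = a ^ (i * p + i + p + 1) := by rw [← pow_add, e]

theorem Subsemigroup.pow_succ_mem {M : Type*} [Monoid M] (S : Subsemigroup M) {a : M} (ha : a ∈ S)
    (k : ℕ) : a ^ (k + 1) ∈ S := by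
  induction k with
  | zero => simpa using ha
  | succ k ih =>
    rw [pow_succ]
    exact S.mul_mem ih ha

theorem Subsemigroup.exists_eq_mul_of_mem_closure {M : Type*} [Monoid M] {A : Set M} {x : M}
    (hx : x ∈ Subsemigroup.closure A) :
    (∃ a ∈ A, ∃ b, x = a * b) ∧ ∃ a ∈ A, ∃ b, x = b * a := by
  induction hx using Subsemigroup.closure_induction with
  | mem x hx => exact ⟨⟨x, hx, 1, (mul_one x).symm⟩, ⟨x, hx, 1, (one_mul x).symm⟩⟩
  | mul x y _ _ hx hy =>
    obtain ⟨⟨a, ha, b, rfl⟩, -⟩ := hx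
    obtain ⟨-, ⟨c, hc, d, rfl⟩⟩ := hy
    exact ⟨⟨a, ha, b * (d * c), mul_assoc _ _ _⟩, ⟨c, hc, a * b * d, (mul_assoc _ _ _).symm⟩⟩

instance Setoid.instFinite {α : Type*} [Finite α] : Finite (Setoid α) :=
  Finite.of_injective (fun s : Setoid α => fun x y => s x y) fun _ _ h =>
    Setoid.ext fun a b => iff_of_eq (congrFun (congrFun h a) b)

namespace PartitionMonoid

variable {n : ℕ}

instance : Finite (PartitionMonoid n) :=
  Finite.of_injective PartitionMonoid.eqv fun _ _ h => PartitionMonoid.ext h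

/-! ### The left and right projections of a product -/

theorem star_mul_mem_projections (α : PartitionMonoid n) : α.star * α ∈ projections n α.rank :=
  ⟨α.star, rank_star α, by rw [star_star]⟩

/-- Composition of arrows: when the target of `α` is the source of `β`, the product keeps the source
of `α`. The next lemma gives the target. -/
theorem mul_mul_star_of_eq {α β : PartitionMonoid n} (h : α.star * α = β * β.star) :
    (α * β) * (α * β).star = α * α.star := by
  rw [star_mul, mul_assoc, ← mul_assoc β, ← h, mul_assoc, ← mul_assoc α, ← mul_assoc (α * α.star),
    mul_star_mul]

theorem star_mul_mul_of_eq {α β : PartitionMonoid n} (h : α.star * α = β * β.star) :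
    (α * β).star * (α * β) = β.star * β := by
  rw [star_mul, mul_assoc, ← mul_assoc α.star, h, mul_star_mul]

/-- Comparable projections of the same rank are equal. -/
theorem eq_of_mul_eq_of_mem_projections {r : ℕ} {p q : PartitionMonoid n}
    (hp : p ∈ projections n r) (hq : q ∈ projections n r) (h : q * p = p) : p = q := by
  -- Since the ranks agree, there is an arrow `α` from `q` to `p`. Finiteness enters through an
  -- idempotent power of `α`: it turns out to equal `q`, and it absorbs `p` on the right.
  obtain ⟨α, h1, h2⟩ : ∃ α : PartitionMonoid n, α * α.star = q ∧ α.star * α = p := by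
    obtain ⟨P, rfl⟩ := mem_projections_iff.1 hp
    obtain ⟨Q, rfl⟩ := mem_projections_iff.1 hq
    exact ⟨glue Q P, by rw [glue_star, glue_mul_glue_self], by rw [glue_star, glue_mul_glue_self]⟩
  have h' : p * q = p := by
    have := congrArg star h
    rwa [star_mul, star_eq_of_mem_projections hp, star_eq_of_mem_projections hq] at this
  have hαp : α * p = α := by rw [← h2, ← mul_assoc, mul_star_mul]
  have hαq : α * q = α := by rw [← hαp, mul_assoc, h']
  have hpow : ∀ k, α ^ (k + 1) * α.star ^ (k + 1) = q := by
    intro k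
    induction k with
    | zero => simpa using h1
    | succ k ih =>
      rw [pow_succ α, pow_succ' α.star, mul_assoc, ← mul_assoc α, h1, ← mul_assoc, pow_succ α,
        mul_assoc _ α q, hαq, ← pow_succ, ih]
  obtain ⟨k, hk⟩ := exists_pow_isIdempotentElem α
  have he : α ^ (k + 1) = q := by
    calc α ^ (k + 1) = α ^ (k + 1) * q := by rw [pow_succ, mul_assoc, hαq]
      _ = q := by rw [← hpow k, ← mul_assoc, hk.eq]
  calc p = q * p := h.symm
    _ = q := by rw [← he, pow_succ, mul_assoc, hαp]

/-! ### Generating sets meet every left and right class -/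

/-- The first and last factors of a factorisation of `p` do it: they have rank `r`, as ranks only
drop in products, and their projections are comparable with `p`, hence equal to it. -/
theorem exists_mul_star_eq_of_closure_eq {r : ℕ} {A : Set (PartitionMonoid n)}
    (hA : Subsemigroup.closure A = ideal n r) {p : PartitionMonoid n} (hp : p ∈ projections n r) :
    (∃ α ∈ A, α.rank = r ∧ α * α.star = p) ∧ ∃ α ∈ A, α.rank = r ∧ α.star * α = p := by
  have hmem : p ∈ Subsemigroup.closure A := by
    rw [hA]
    exact (rank_of_mem_projections hp).le
  have hle : ∀ α ∈ A, α.rank ≤ r := fun α hα => by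
    have : α ∈ ideal n r := hA ▸ Subsemigroup.subset_closure hα
    exact this
  obtain ⟨⟨α, hα, β, hαβ⟩, ⟨γ, hγ, δ, hδγ⟩⟩ := Subsemigroup.exists_eq_mul_of_mem_closure hmem
  have hrp := rank_of_mem_projections hp
  refine ⟨⟨α, hα, ?_⟩, ⟨γ, hγ, ?_⟩⟩
  · have hr : α.rank = r := le_antisymm (hle α hα) (by
      rw [← hrp, hαβ]
      exact rank_mul_le_left _ _)
    refine ⟨hr, (eq_of_mul_eq_of_mem_projections hp ⟨α, hr, rfl⟩ ?_).symm⟩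
    rw [hαβ, ← mul_assoc, mul_star_mul]
  · have hr : γ.rank = r := le_antisymm (hle γ hγ) (by
      rw [← hrp, hδγ]
      exact rank_mul_le_right _ _)
    refine ⟨hr, (eq_of_mul_eq_of_mem_projections hp (hr ▸ star_mul_mem_projections γ) ?_).symm⟩
    have h : p * (γ.star * γ) = p := by
      rw [hδγ, mul_assoc, ← mul_assoc γ, mul_star_mul]
    have h' := congrArg star h
    rwa [star_mul, star_mul, star_star, star_eq_of_mem_projections hp] at h'

/-! ### Transversals of the left and right classes generate -/

/-- An arrow from a projection to itself lies in a finite group whose identity is that projection,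
so its idempotent power is the projection. -/
theorem mem_closure_of_mul_star_eq_star_mul {A : Set (PartitionMonoid n)} {α : PartitionMonoid n}
    (hα : α ∈ Subsemigroup.closure A) (h : α.star * α = α * α.star) :
    α * α.star ∈ Subsemigroup.closure A := by
  have hpow : ∀ k, α ^ (k + 1) * (α ^ (k + 1)).star = α * α.star ∧
      (α ^ (k + 1)).star * α ^ (k + 1) = α * α.star := by
    intro k
    induction k with
    | zero => simpa using h
    | succ k ih =>
      rw [pow_succ]
      exact ⟨(mul_mul_star_of_eq ih.2).trans ih.1, (star_mul_mul_of_eq ih.2).trans h⟩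
  obtain ⟨k, hk⟩ := exists_pow_isIdempotentElem α
  have he : α ^ (k + 1) = α * α.star := by
    calc α ^ (k + 1) = α ^ (k + 1) * (α ^ (k + 1)).star * α ^ (k + 1) := (mul_star_mul _).symm
      _ = (α ^ (k + 1)).star * α ^ (k + 1) * α ^ (k + 1) := by rw [(hpow k).1, (hpow k).2]
      _ = α * α.star := by rw [mul_assoc, hk.eq, (hpow k).2]
  rw [← he]
  exact Subsemigroup.pow_succ_mem _ hα k

theorem projections_subset_closure {r : ℕ} {A : Finset (PartitionMonoid n)}
    (hcard : A.card = (projections n r).ncard) (hrank : ∀ α ∈ A, α.rank = r)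
    (hl : ∀ α ∈ A, ∀ β ∈ A, α * α.star = β * β.star → α = β)
    (hr : ∀ α ∈ A, ∀ β ∈ A, α.star * α = β.star * β → α = β) :
    projections n r ⊆ Subsemigroup.closure (A : Set (PartitionMonoid n)) := by
  have hsurj : ∀ p : projections n r, ∃ α ∈ A, α * α.star = p := by
    have himage : (fun α => α * α.star) '' (A : Set (PartitionMonoid n)) = projections n r := by
      refine Set.eq_of_subset_of_ncard_le ?_ ?_ (Set.toFinite _)
      · rintro _ ⟨α, hα, rfl⟩
        exact ⟨α, hrank α hα, rfl⟩
      · rw [Set.InjOn.ncard_image fun α hα β hβ h => hl α hα β hβ h, Set.ncard_coe_finset, hcard]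
    rintro ⟨p, hp⟩
    rw [← himage] at hp
    exact hp
  choose a ha hap using hsurj
  let f : projections n r → projections n r := fun p =>
    ⟨(a p).star * a p, hrank _ (ha p) ▸ star_mul_mem_projections (a p)⟩
  have hf : Function.Injective f := by
    intro p q h
    have h1 := hr _ (ha p) _ (ha q) (congrArg Subtype.val h)
    apply Subtype.ext
    rw [← hap, ← hap, h1]
  -- Each projection `p` is the source of the chosen `a p` in `A`, and `σ` sends `p` to the target
  -- of that arrow. Composing the arrows met along an orbit of `σ` stays in the closure of `A`.
  let σ : Equiv.Perm (projections n r) := Equiv.ofBijective f (Finite.injective_iff_bijective.1 hf)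
  have hσ : ∀ p, (σ p : PartitionMonoid n) = (a p).star * a p := fun p => rfl
  have key : ∀ (p : projections n r) (k : ℕ),
      ∃ β ∈ Subsemigroup.closure (A : Set (PartitionMonoid n)),
        β * β.star = p ∧ β.star * β = (σ ^ (k + 1)) p := by
    intro p k
    induction k with
    | zero => exact ⟨a p, Subsemigroup.subset_closure (ha p), hap p, by simp [hσ]⟩
    | succ k ih =>
      obtain ⟨β, hβ, h1, h2⟩ := ih
      have h3 : β.star * β = a ((σ ^ (k + 1)) p) * (a ((σ ^ (k + 1)) p)).star := by rw [hap, h2]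
      refine ⟨β * a ((σ ^ (k + 1)) p), Subsemigroup.mul_mem _ hβ
        (Subsemigroup.subset_closure (ha _)), (mul_mul_star_of_eq h3).trans h1, ?_⟩
      rw [star_mul_mul_of_eq h3, pow_succ' σ (k + 1), Equiv.Perm.mul_apply, hσ]
  intro p hp
  -- A path of length `orderOf σ` returns to `p`; the `- 1` offsets the exponent `k + 1` in `key`.
  obtain ⟨β, hβ, h1, h2⟩ := key ⟨p, hp⟩ (orderOf σ - 1)
  rw [Nat.sub_add_cancel (orderOf_pos σ), pow_orderOf_eq_one] at h2
  have h1' : β * β.star = p := h1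
  rw [← h1']
  exact mem_closure_of_mul_star_eq_star_mul hβ (h2.trans h1.symm)

/-! ### Ranks and minimal generating sets of the ideals -/

theorem isIdempotentGenerated_ideal {r : ℕ} (hr : r < n) : IsIdempotentGenerated (ideal n r) := by
  refine le_antisymm (Subsemigroup.closure_le.2 fun e he => he.1) ?_
  conv_lhs => rw [← closure_projections hr]
  exact Subsemigroup.closure_mono fun p hp =>
    ⟨(rank_of_mem_projections hp).le, isIdempotentElem_of_mem_projections hp⟩

theorem ncard_projections_le {r : ℕ} {A : Finset (PartitionMonoid n)}
    (hA : Subsemigroup.closure (A : Set (PartitionMonoid n)) = ideal n r) :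
    (projections n r).ncard ≤ A.card := by
  have h : projections n r ⊆ (fun α => α * α.star) '' (A : Set (PartitionMonoid n)) := by
    intro p hp
    obtain ⟨⟨α, hα, -, h⟩, -⟩ := exists_mul_star_eq_of_closure_eq hA hp
    exact ⟨α, hα, h⟩
  calc (projections n r).ncard ≤ _ := Set.ncard_le_ncard h (Set.toFinite _)
    _ ≤ (A : Set (PartitionMonoid n)).ncard := Set.ncard_image_le (Set.toFinite _)
    _ = A.card := Set.ncard_coe_finset A

theorem semigroupIdempotentRank_ideal {r : ℕ} (hr : r < n) :
    semigroupIdempotentRank (ideal n r) = (projections n r).ncard := by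
  have hfin : (projections n r).Finite := Set.toFinite _
  have hmem : (projections n r).ncard ∈ {k | ∃ A : Finset (PartitionMonoid n),
      (∀ e ∈ A, IsIdempotentElem e) ∧
      Subsemigroup.closure (A : Set (PartitionMonoid n)) = ideal n r ∧ A.card = k} := by
    refine ⟨hfin.toFinset, fun e he => ?_, ?_, (Set.ncard_eq_toFinset_card _ hfin).symm⟩
    · exact isIdempotentElem_of_mem_projections (hfin.mem_toFinset.1 he)
    · rw [hfin.coe_toFinset, closure_projections hr]
  refine le_antisymm (Nat.sInf_le hmem) (le_csInf ⟨_, hmem⟩ ?_)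
  rintro k ⟨A, -, hA, rfl⟩
  exact ncard_projections_le hA

theorem semigroupRank_ideal {r : ℕ} (hr : r < n) :
    semigroupRank (ideal n r) = (projections n r).ncard := by
  have hfin : (projections n r).Finite := Set.toFinite _
  have hmem : (projections n r).ncard ∈ {k | ∃ A : Finset (PartitionMonoid n),
      Subsemigroup.closure (A : Set (PartitionMonoid n)) = ideal n r ∧ A.card = k} := by
    refine ⟨hfin.toFinset, ?_, (Set.ncard_eq_toFinset_card _ hfin).symm⟩
    rw [hfin.coe_toFinset, closure_projections hr]
  refine le_antisymm (Nat.sInf_le hmem) (le_csInf ⟨_, hmem⟩ ?_)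
  rintro k ⟨A, hA, rfl⟩
  exact ncard_projections_le hA

/-- If `A` generates, its elements of rank `r` already hit every projection, so by counting they are
all of `A`, and the surjections of `A` onto the projections are injective. The converse is the
permutation argument. -/
theorem closure_eq_ideal_iff {r : ℕ} (hr : r < n) {A : Finset (PartitionMonoid n)}
    (hcard : A.card = (projections n r).ncard) :
    Subsemigroup.closure (A : Set (PartitionMonoid n)) = ideal n r ↔
      (∀ α ∈ A, α.rank = r) ∧
      (∀ α ∈ A, ∀ β ∈ A, α * α.star = β * β.star → α = β) ∧
      (∀ α ∈ A, ∀ β ∈ A, α.star * α = β.star * β → α = β) := by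
  classical
  constructor
  · intro hA
    have hsub : projections n r ⊆
        (fun α => α * α.star) '' ((A.filter fun α => α.rank = r : Finset _) :
          Set (PartitionMonoid n)) := by
      intro p hp
      obtain ⟨⟨α, hα, hr, h⟩, -⟩ := exists_mul_star_eq_of_closure_eq hA hp
      exact ⟨α, Finset.mem_coe.2 (Finset.mem_filter.2 ⟨hα, hr⟩), h⟩
    have hfilter : A.filter (fun α => α.rank = r) = A := by
      refine Finset.eq_of_subset_of_card_le (Finset.filter_subset _ _) ?_
      rw [hcard, ← Set.ncard_coe_finset]
      exact (Set.ncard_le_ncard hsub (Set.toFinite _)).trans (Set.ncard_image_le (Set.toFinite _))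
    have hrank : ∀ α ∈ A, α.rank = r := Finset.filter_eq_self.1 hfilter
    have hinj : ∀ f : PartitionMonoid n → PartitionMonoid n,
        projections n r ⊆ f '' (A : Set (PartitionMonoid n)) →
        ∀ α ∈ A, ∀ β ∈ A, f α = f β → α = β := by
      intro f hf α hα β hβ h
      refine Set.injOn_of_ncard_image_eq ?_ (Set.toFinite _) hα hβ h
      refine le_antisymm (Set.ncard_image_le (Set.toFinite _)) ?_
      rw [Set.ncard_coe_finset, hcard]
      exact Set.ncard_le_ncard hf (Set.toFinite _)
    refine ⟨hrank, hinj (fun α => α * α.star) fun p hp => ?_,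
      hinj (fun α => α.star * α) fun p hp => ?_⟩
    · obtain ⟨⟨α, hα, -, h⟩, -⟩ := exists_mul_star_eq_of_closure_eq hA hp
      exact ⟨α, hα, h⟩
    · obtain ⟨-, ⟨α, hα, -, h⟩⟩ := exists_mul_star_eq_of_closure_eq hA hp
      exact ⟨α, hα, h⟩
  · rintro ⟨h1, h2, h3⟩
    refine le_antisymm (Subsemigroup.closure_le.2 fun α hα => (h1 α hα).le) ?_
    rw [← closure_projections hr]
    exact Subsemigroup.closure_le.2 (projections_subset_closure hcard h1 h2 h3)

end PartitionMonoid

/-! ### Identities for binomial, Stirling and Bell numbers -/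

theorem Nat.mul_choose_eq (j r : ℕ) : j * j.choose r = (r + 1) * j.choose (r + 1) + r * j.choose r := by
  rcases le_or_gt r j with h | h
  · obtain ⟨d, rfl⟩ := Nat.exists_eq_add_of_le h
    have := Nat.choose_succ_right_eq (r + d) r
    rw [Nat.add_sub_cancel_left] at this
    linarith
  · simp [Nat.choose_eq_zero_of_lt h, Nat.choose_eq_zero_of_lt (Nat.lt_succ_of_lt h)]

/-- The recurrence of the Stirling transform. -/
theorem sum_stirlingSecond_mul_succ (n : ℕ) (f : ℕ → ℕ) :
    ∑ j ∈ Finset.range (n + 2), Nat.stirlingSecond (n + 1) j * f j =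
      ∑ j ∈ Finset.range (n + 1), Nat.stirlingSecond n j * (j * f j + f (j + 1)) := by
  have h1 : ∑ j ∈ Finset.range (n + 1), Nat.stirlingSecond n j * (j * f j) =
      ∑ j ∈ Finset.range (n + 1), (j + 1) * Nat.stirlingSecond n (j + 1) * f (j + 1) := by
    rw [Finset.sum_range_succ', Finset.sum_range_succ]
    simp [Nat.stirlingSecond_eq_zero_of_lt (Nat.lt_succ_self n)]
    exact Finset.sum_congr rfl fun j _ => by ring
  rw [Finset.sum_range_succ']
  simp only [Nat.stirlingSecond_succ_zero, Nat.stirlingSecond_succ_succ, mul_add, add_mul,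
    Finset.sum_add_distrib, zero_mul, add_zero] at h1 ⊢
  rw [h1]

theorem sum_choose_mul_succ (n : ℕ) (f : ℕ → ℕ) :
    ∑ j ∈ Finset.range (n + 2), Nat.choose (n + 1) j * f j =
      ∑ j ∈ Finset.range (n + 1), Nat.choose n j * (f j + f (j + 1)) := by
  have h1 : ∑ j ∈ Finset.range (n + 1), Nat.choose n j * f j =
      ∑ j ∈ Finset.range (n + 1), Nat.choose n (j + 1) * f (j + 1) + f 0 := by
    rw [Finset.sum_range_succ', Finset.sum_range_succ (fun j => Nat.choose n (j + 1) * f (j + 1))]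
    simp
  rw [Finset.sum_range_succ']
  simp only [Nat.choose_succ_succ, mul_add, add_mul, Finset.sum_add_distrib, h1]
  simp
  ring

/-- Combinatorially: in a partition of `n + 1` points into `r + 1` classes, remove the class of an
extra point; the remaining `j` points form `r` classes. -/
theorem sum_choose_mul_stirlingSecond (n r : ℕ) :
    ∑ j ∈ Finset.range (n + 1), Nat.choose n j * Nat.stirlingSecond j r =
      Nat.stirlingSecond (n + 1) (r + 1) := by
  induction n generalizing r with
  | zero => cases r <;> simp [Nat.stirlingSecond]
  | succ n ih =>
    rw [sum_choose_mul_succ]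
    simp only [mul_add, Finset.sum_add_distrib, ih]
    cases r with
    | zero =>
      simp [Nat.stirlingSecond_succ_succ]
    | succ r =>
      have h : ∑ j ∈ Finset.range (n + 1), n.choose j * Nat.stirlingSecond (j + 1) (r + 1) =
          (r + 1) * Nat.stirlingSecond (n + 1) (r + 2) + Nat.stirlingSecond (n + 1) (r + 1) := by
        rw [← ih r, ← ih (r + 1), Finset.mul_sum, ← Finset.sum_add_distrib]
        exact Finset.sum_congr rfl fun j _ => by rw [Nat.stirlingSecond_succ_succ]; ring
      rw [h, Nat.stirlingSecond_succ_succ (n + 1) (r + 1)]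
      ring

theorem bell_succ_range (m : ℕ) :
    Nat.bell (m + 1) = ∑ k ∈ Finset.range (m + 1), m.choose k * Nat.bell (m - k) := by
  rw [Nat.bell_succ, Nat.range_succ_eq_Iic]

theorem sum_choose_stirlingSecond_bell_succ (n r : ℕ) :
    ∑ j ∈ Finset.range (n + 1), n.choose j * Nat.stirlingSecond j r * Nat.bell (n - j + 1) =
      ∑ i ∈ Finset.range (n + 1), n.choose i * Nat.stirlingSecond (i + 1) (r + 1) *
        Nat.bell (n - i) := by
  simp only [← sum_choose_mul_stirlingSecond, bell_succ_range, Finset.mul_sum, Finset.sum_mul]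
  rw [Finset.sum_sigma', Finset.sum_sigma']
  -- After expanding the Bell number on the left and the Stirling number on the right, both are
  -- double sums, matched by `i = j + k`.
  refine Finset.sum_bij' (fun x _ => ⟨x.1 + x.2, x.1⟩) (fun x _ => ⟨x.2, x.1 - x.2⟩)
    ?_ ?_ ?_ ?_ ?_
  · rintro ⟨j, k⟩ h
    simp at h ⊢
    omega
  · rintro ⟨i, j⟩ h
    simp at h ⊢
    omega
  · rintro ⟨j, k⟩ h
    simp
  · rintro ⟨i, j⟩ h
    simp at h ⊢
    omega
  · rintro ⟨j, k⟩ h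
    simp at h
    have h1 : n.choose (j + k) * (j + k).choose j = n.choose j * (n - j).choose k := by
      rw [Nat.choose_mul (Nat.le_add_right j k), Nat.add_sub_cancel_left]
    have h2 : n - j - k = n - (j + k) := by omega
    dsimp only
    rw [h2]
    calc _ = n.choose j * (n - j).choose k * Nat.stirlingSecond j r * Nat.bell (n - (j + k)) := by
          ring
      _ = _ := by rw [← h1]; ring

/-- Both sides count equivalence relations with `r` chosen classes, on the right sorted by the size
`j` of the union of the chosen classes. The proof shows that both satisfy `a (n+1) r = (r+1) * a n
(r+1) + (r+1) * a n r + a n (r-1)`, the last term being absent for `r = 0`. -/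
theorem sum_stirlingSecond_choose_eq_range (n r : ℕ) :
    ∑ j ∈ Finset.range (n + 1), Nat.stirlingSecond n j * Nat.choose j r =
      ∑ j ∈ Finset.range (n + 1), Nat.choose n j * Nat.stirlingSecond j r * Nat.bell (n - j) := by
  induction n generalizing r with
  | zero => cases r <;> simp
  | succ n ih =>
    have hL : ∑ j ∈ Finset.range (n + 2), Nat.stirlingSecond (n + 1) j * Nat.choose j r =
        (r + 1) * ∑ j ∈ Finset.range (n + 1), Nat.stirlingSecond n j * Nat.choose j (r + 1) +
        r * ∑ j ∈ Finset.range (n + 1), Nat.stirlingSecond n j * Nat.choose j r +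
        ∑ j ∈ Finset.range (n + 1), Nat.stirlingSecond n j * Nat.choose (j + 1) r := by
      rw [sum_stirlingSecond_mul_succ, Finset.mul_sum, Finset.mul_sum, ← Finset.sum_add_distrib,
        ← Finset.sum_add_distrib]
      exact Finset.sum_congr rfl fun j _ => by rw [Nat.mul_choose_eq]; ring
    have hR : ∑ j ∈ Finset.range (n + 2), Nat.choose (n + 1) j * Nat.stirlingSecond j r *
        Nat.bell (n + 1 - j) =
        ∑ j ∈ Finset.range (n + 1), n.choose j * Nat.stirlingSecond (j + 1) (r + 1) *
          Nat.bell (n - j) +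
        ∑ j ∈ Finset.range (n + 1), n.choose j * Nat.stirlingSecond (j + 1) r *
          Nat.bell (n - j) := by
      rw [← sum_choose_stirlingSecond_bell_succ]
      simp only [mul_assoc]
      rw [sum_choose_mul_succ, ← Finset.sum_add_distrib]
      refine Finset.sum_congr rfl fun j hj => ?_
      have : j ≤ n := by simpa [Nat.lt_succ_iff] using hj
      rw [Nat.add_sub_add_right, Nat.sub_add_comm this]
      ring
    have hS : ∀ s, ∑ j ∈ Finset.range (n + 1), n.choose j * Nat.stirlingSecond (j + 1) (s + 1) *
          Nat.bell (n - j) =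
        (s + 1) * ∑ j ∈ Finset.range (n + 1), Nat.stirlingSecond n j * Nat.choose j (s + 1) +
        ∑ j ∈ Finset.range (n + 1), Nat.stirlingSecond n j * Nat.choose j s := by
      intro s
      rw [ih, ih, Finset.mul_sum, ← Finset.sum_add_distrib]
      exact Finset.sum_congr rfl fun j _ => by rw [Nat.stirlingSecond_succ_succ]; ring
    rw [hL, hR, hS]
    cases r with
    | zero => simp
    | succ r =>
      rw [hS]
      simp only [Nat.choose_succ_succ, mul_add, Finset.sum_add_distrib]
      ring

theorem sum_stirlingSecond_choose_eq (n r : ℕ) :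
    ∑ j ∈ Finset.Icc r n, Nat.stirlingSecond n j * Nat.choose j r =
      ∑ j ∈ Finset.Icc r n, Nat.choose n j * Nat.stirlingSecond j r * Nat.bell (n - j) := by
  have h : Finset.Icc r n ⊆ Finset.range (n + 1) := by
    intro j
    simp
  have h' : ∀ j ∈ Finset.range (n + 1), j ∉ Finset.Icc r n → j < r := by
    intro j
    simp
    omega
  rw [Finset.sum_subset h, Finset.sum_subset h, sum_stirlingSecond_choose_eq_range]
  · intro j hj hj'
    simp [Nat.stirlingSecond_eq_zero_of_lt (h' j hj hj')]
  · intro j hj hj'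
    simp [Nat.choose_eq_zero_of_lt (h' j hj hj')]

/-! ### Counting equivalence relations -/

/-- An equivalence relation on `n + 1` points is determined by its restriction `K` to the last `n`
points, and by the class of `K` to which the first point belongs, if any. -/
def Setoid.finCons {n : ℕ} (x : Σ K : Setoid (Fin n), Option (Quotient K)) :
    Setoid (Fin (n + 1)) :=
  Setoid.ker (Fin.cons x.2 fun i => some (Quotient.mk x.1 i) : Fin (n + 1) → Option (Quotient x.1))

theorem Setoid.finCons_rel {n : ℕ} {K : Setoid (Fin n)} {o : Option (Quotient K)}
    {i j : Fin (n + 1)} : Setoid.finCons ⟨K, o⟩ i j ↔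
      (Fin.cons o fun i => some (Quotient.mk K i) : Fin (n + 1) → Option (Quotient K)) i =
      (Fin.cons o fun i => some (Quotient.mk K i) : Fin (n + 1) → Option (Quotient K)) j :=
  Iff.rfl

theorem Setoid.finCons_bijective (n : ℕ) : Function.Bijective (Setoid.finCons (n := n)) := by
  constructor
  · rintro ⟨K, o⟩ ⟨K', o'⟩ h
    have h1 := Setoid.ext_iff.1 h
    simp only [Setoid.finCons_rel] at h1
    have hK : K = K' := by
      ext i j
      simpa [Quotient.eq] using h1 i.succ j.succ
    subst hK
    have ho : o = o' := by
      apply Option.ext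
      intro q
      obtain ⟨i, rfl⟩ := Quotient.exists_rep q
      simpa using h1 0 i.succ
    rw [ho]
  · intro s
    classical
    let K : Setoid (Fin n) := Setoid.comap Fin.succ s
    -- The points `i.succ` related to `0` form a single class of `K` or none, so the choice of `i`
    -- does not matter.
    let o : Option (Quotient K) :=
      if h : ∃ i : Fin n, s 0 i.succ then some (Quotient.mk K h.choose) else none
    have ho : ∀ i : Fin n, o = some (Quotient.mk K i) ↔ s 0 i.succ := by
      intro i
      by_cases h : ∃ i : Fin n, s 0 i.succ
      · have h' : K h.choose i ↔ s 0 i.succ :=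
          ⟨fun h' => s.trans' h.choose_spec h', fun h' => s.trans' (s.symm' h.choose_spec) h'⟩
        simp only [o, dif_pos h, Option.some_inj, Quotient.eq]
        exact h'
      · simp only [o, dif_neg h]
        exact iff_of_false (by simp) fun h' => h ⟨i, h'⟩
    refine ⟨⟨K, o⟩, ?_⟩
    ext i j
    rw [Setoid.finCons_rel]
    refine Fin.cases ?_ (fun i => ?_) i <;> refine Fin.cases ?_ (fun j => ?_) j
    · exact iff_of_true rfl (s.refl' 0)
    · simpa using ho j
    · rw [Setoid.comm', eq_comm]
      simpa using ho i
    · simp only [Fin.cons_succ, Option.some_inj, Quotient.eq]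
      exact Iff.rfl

/-- The quotient by the kernel of a map is its range, here the classes of `K` with `o` inserted;
only `none` is new. -/
theorem Setoid.card_quotient_finCons {n : ℕ} (K : Setoid (Fin n)) (o : Option (Quotient K)) :
    Nat.card (Quotient (Setoid.finCons ⟨K, o⟩)) =
      if o = none then Nat.card (Quotient K) + 1 else Nat.card (Quotient K) := by
  have hr : Set.range (fun i => some (Quotient.mk K i)) = Set.range (some : Quotient K → _) :=
    (Quotient.mk_surjective (s := K)).range_comp some
  rw [Setoid.finCons, Nat.card_congr (Setoid.quotientKerEquivRange _), Nat.card_coe_set_eq, Fin.range_cons, hr]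
  have hc : (Set.range (some : Quotient K → _)).ncard = Nat.card (Quotient K) :=
    Set.ncard_range_of_injective (Option.some_injective _)
  cases o with
  | none => rw [Set.ncard_insert_of_notMem (by simp) (Set.toFinite _), hc, if_pos rfl]
  | some q => rw [Set.insert_eq_of_mem (Set.mem_range_self q), hc, if_neg (by simp)]

/-- Equivalence relations with `j` classes are counted by the Stirling numbers of the second
kind. -/
theorem Setoid.sum_card_quotient (n : ℕ) (f : ℕ → ℕ) : ∀ [Fintype (Setoid (Fin n))],
    ∑ K : Setoid (Fin n), f (Nat.card (Quotient K)) =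
      ∑ j ∈ Finset.range (n + 1), Nat.stirlingSecond n j * f j := by
  classical
  induction n generalizing f with
  | zero =>
    intro
    have hu : ∀ K : Setoid (Fin 0), K = ⊤ := fun K => Setoid.ext fun i => i.elim0
    rw [Fintype.sum_eq_single ⊤ fun K hK => absurd (hu K) hK]
    have : IsEmpty (Quotient (⊤ : Setoid (Fin 0))) := ⟨fun q => q.exists_rep.choose.elim0⟩
    simp
  | succ n ih =>
    intro
    have := Fintype.ofFinite (Setoid (Fin n))
    have (K : Setoid (Fin n)) := Fintype.ofFinite (Quotient K)
    -- A relation `K` with `j` classes has `j` extensions with `j` classes and one with `j + 1`,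
    -- which is the summand `j * f j + f (j + 1)`.
    rw [sum_stirlingSecond_mul_succ, ← ih, ← Fintype.sum_bijective _ (Setoid.finCons_bijective n) _ _
      fun _ => rfl, Fintype.sum_sigma]
    refine Finset.sum_congr rfl fun K _ => ?_
    rw [Fintype.sum_option]
    simp only [Setoid.card_quotient_finCons]
    simp [Nat.card_eq_fintype_card, add_comm]

namespace PartitionMonoid

variable {n : ℕ}

/-! ### Counting projections -/

/-- The half diagram of an equivalence relation and a set of its classes. -/
noncomputable def ofClasses (K : Setoid (Fin n)) (T : Finset (Quotient K)) :
    HalfDiagram n T :=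
  ⟨K, fun q => q.1.out, fun p q h => by
    have h' := Quotient.sound (s := K) h
    rw [Quotient.out_eq, Quotient.out_eq] at h'
    exact Subtype.ext h'⟩

theorem mem_dom_ofClasses {K : Setoid (Fin n)} {T : Finset (Quotient K)} {i : Fin n} :
    (∃ x, (ofClasses K T).rel i ((ofClasses K T).pt x)) ↔ Quotient.mk K i ∈ T := by
  constructor
  · rintro ⟨x, h⟩
    have h' : Quotient.mk K i = Quotient.mk K x.1.out := Quotient.sound (s := K) h
    rw [h', Quotient.out_eq]
    exact x.2
  · intro h
    exact ⟨⟨_, h⟩, K.symm' (Quotient.mk_out (s := K) i)⟩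

/-- A projection is determined by its kernel and its domain, that is, by an equivalence relation and
`r` of its classes; `j` classes allow `j.choose r` choices. -/
theorem ncard_projections (n r : ℕ) : (projections n r).ncard =
    ∑ j ∈ Finset.Icc r n, Nat.stirlingSecond n j * Nat.choose j r := by
  classical
  let Φ : (Σ K : Setoid (Fin n), {T : Finset (Quotient K) // T.card = r}) → PartitionMonoid n :=
    fun x => glue (ofClasses x.1 x.2) (ofClasses x.1 x.2)
  have hinj : Function.Injective Φ := by
    rintro ⟨K, T, hT⟩ ⟨K', T', hT'⟩ h
    have hK : K = K' := congrArg ker h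
    subst hK
    have hd : (Φ ⟨K, T, hT⟩).dom = (Φ ⟨K, T', hT'⟩).dom := congrArg dom h
    simp only [Φ, dom_glue, mem_dom_ofClasses] at hd
    have : T = T' := by
      ext q
      obtain ⟨i, rfl⟩ := Quotient.exists_rep q
      exact Set.ext_iff.1 hd i
    subst this
    rfl
  have hrange : Set.range Φ = projections n r := by
    ext p
    constructor
    · rintro ⟨⟨K, T, hT⟩, rfl⟩
      exact ⟨Φ ⟨K, T, hT⟩, by simp [Φ, rank_glue, hT], glue_mul_star _ _⟩
    · intro hp
      obtain ⟨P, rfl⟩ := mem_projections_iff.1 hp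
      let T : Finset (Quotient P.rel) := Finset.univ.image fun x => Quotient.mk P.rel (P.pt x)
      have hT : T.card = r := by
        rw [Finset.card_image_of_injective _ fun x y h => P.sep x y (Quotient.exact h)]
        simp
      refine ⟨⟨P.rel, T, hT⟩, glue_self_congr rfl fun i => ?_⟩
      rw [mem_dom_ofClasses]
      simp only [T, Finset.mem_image, Finset.mem_univ, true_and, Quotient.eq]
      exact exists_congr fun x => ⟨fun h => P.rel.symm' h, fun h => P.rel.symm' h⟩
  have := Fintype.ofFinite (Setoid (Fin n))
  have (K : Setoid (Fin n)) := Fintype.ofFinite (Quotient K)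
  rw [← hrange, Set.ncard_range_of_injective hinj, Nat.card_sigma]
  have hc : ∀ K : Setoid (Fin n), Nat.card {T : Finset (Quotient K) // T.card = r} =
      (Nat.card (Quotient K)).choose r := fun K => by
    rw [Nat.card_eq_fintype_card, Fintype.card_finset_len, Nat.card_eq_fintype_card]
  simp only [hc]
  rw [Setoid.sum_card_quotient n fun j => j.choose r]
  refine (Finset.sum_subset (fun j => by simp) fun j hj hj' => ?_).symm
  have : j < r := by simp at hj hj'; omega
  rw [Nat.choose_eq_zero_of_lt this, mul_zero]

end PartitionMonoid

/-! ### The theorem -/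

theorem mainTheorem1 (n r : ℕ) (hr : r < n) :
    PartitionMonoid.IsIdempotentGenerated (PartitionMonoid.ideal n r) ∧
    PartitionMonoid.semigroupRank (PartitionMonoid.ideal n r) =
      ∑ j ∈ Finset.Icc r n, Nat.stirlingSecond n j * Nat.choose j r ∧
    PartitionMonoid.semigroupIdempotentRank (PartitionMonoid.ideal n r) =
      ∑ j ∈ Finset.Icc r n, Nat.stirlingSecond n j * Nat.choose j r ∧
    ∑ j ∈ Finset.Icc r n, Nat.stirlingSecond n j * Nat.choose j r =
      ∑ j ∈ Finset.Icc r n, Nat.choose n j * Nat.stirlingSecond j r * Nat.bell (n - j) ∧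
    ∀ A : Finset (PartitionMonoid n),
      (∀ α ∈ A, α ∈ PartitionMonoid.ideal n r) →
      A.card = ∑ j ∈ Finset.Icc r n, Nat.stirlingSecond n j * Nat.choose j r →
      (Subsemigroup.closure (A : Set (PartitionMonoid n)) = PartitionMonoid.ideal n r ↔
        (∀ α ∈ A, α.rank = r) ∧
        (∀ α ∈ A, ∀ β ∈ A, α ≠ β → α.ker ≠ β.ker ∨ α.dom ≠ β.dom) ∧
        (∀ α ∈ A, ∀ β ∈ A, α ≠ β → α.coker ≠ β.coker ∨ α.codom ≠ β.codom)) := by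
  rw [← PartitionMonoid.ncard_projections]
  refine ⟨PartitionMonoid.isIdempotentGenerated_ideal hr, PartitionMonoid.semigroupRank_ideal hr,
    PartitionMonoid.semigroupIdempotentRank_ideal hr, ?_, fun A _ hA => ?_⟩
  · rw [PartitionMonoid.ncard_projections, sum_stirlingSecond_choose_eq]
  · rw [PartitionMonoid.closure_eq_ideal_iff hr hA]
    -- Conditions (2) and (3) are the contrapositives of the two injectivity statements.
    simp only [PartitionMonoid.mul_star_eq_mul_star_iff, PartitionMonoid.star_mul_eq_star_mul_iff,
      ne_eq, ← not_and_or, not_imp_not]
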